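/- Let $k\ge 2$. A $k$-graph $H$ consists of a finite vertex set $V(H)$ and a set $E(H)$ of $k$-element subsets of $V(H)$, called edges. For $X_1,\dots,X_k\subseteq V(H)$ let $e(X_1,\dots,X_k)$ be the number of tuples $(x_1,\dots,x_k)\in X_1\times\cdots\times X_k$ such that $\{x_1,\dots,x_k\}\in E(H)$. For real numbers $0<p,\mu,\alpha<1$, an $(n,p,\mu,\alpha)$ $k$-graph is a $k$-graph $H$ with $|V(H)|=n$ such that $$e(X_1,\dots,X_k)\ \ge\ p\,|X_1|\cdots|X_k|-\mu n^k\qquad\text{for all } X_1,\dots,X_k\subseteq V(H),$$ and such that every vertex of $H$ lies in at least $\alpha\binom{n}{k-1}$ edges. A copy of a $k$-graph $F$ in $H$ is the image of $F$ under an injective map $V(F)\to V(H)$ that maps every edge of $F$ to an edge of $H$. A perfect $F$-packing of $H$ is a collection of pairwise vertex-disjoint copies of $F$ in $H$ whose vertex sets partition $V(H)$. The cherry $K_{1,1,2}$ is the $3$-graph with vertex set $\{1,2,3,4\}$ and edges $\{1,2,3\},\{1,2,4\}$. The $3$-graph $C_4(2+1)$ has vertex set $\{1,2,3,4,a,b\}$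 and edges $\{1,2,a\},\{1,2,b\},\{3,4,a\},\{3,4,b\}$. **Theorem.** Let $0<\alpha,p<1$. There exist $n_0$ and $0<\mu<1$ such that every $(n,p,\mu,\alpha)$ $3$-graph $H$ with $n\ge n_0$ has a perfect cherry packing if $4\mid n$, and has a perfect $C_4(2+1)$-packing if $6\mid n$. -/

import Mathlib

open scoped Hypergraph

namespace Hypergraph

/-- A hypergraph on a finite vertex set all of whose edges have exactly `k` vertices
(a "`k`-graph"). -/
def IsKGraph {V : Type*} (H : Hypergraph V) (k : ℕ) : Prop :=
  V(H).Finite ∧ ∀ e ∈ E(H), e.ncard = k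

/-- The number `e(X₁, …, X_k)` of tuples `(x₁, …, x_k) ∈ X₁ × ⋯ × X_k` for which
`{x₁, …, x_k}` is an edge. The sets `X i` may overlap, so an edge may be counted several times;
if `H` is a `k`-graph then a tuple with a repeated entry is never counted. -/
noncomputable def edgeTuples {V : Type*} (H : Hypergraph V) {k : ℕ} (X : Fin k → Set V) : ℕ :=
  {x : Fin k → V | (∀ i, x i ∈ X i) ∧ Set.range x ∈ E(H)}.ncard

/-- `(p, μ)`-denseness of a `k`-graph:
`e(X₁, …, X_k) ≥ p |X₁| ⋯ |X_k| - μ n ^ k` for all vertex sets `X₁, …, X_k`, where `n` is the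
number of vertices. -/
def IsDense {V : Type*} (H : Hypergraph V) (k : ℕ) (p μ : ℝ) : Prop :=
  ∀ X : Fin k → Set V, (∀ i, X i ⊆ V(H)) →
    p * ∏ i, ((X i).ncard : ℝ) - μ * (V(H).ncard : ℝ) ^ k ≤ (H.edgeTuples X : ℝ)

/-- The degree of a vertex: the number of edges containing it. -/
noncomputable def vertexDegree {V : Type*} (H : Hypergraph V) (v : V) : ℕ :=
  {e | e ∈ E(H) ∧ v ∈ e}.ncard

/-- `H` is an `(n, p, μ, α)` `k`-graph: a `(p, μ)`-dense `k`-graph on `n` vertices in which every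
vertex has degree at least `α * (n choose (k - 1))`. -/
structure IsQuasirandomKGraph {V : Type*} (H : Hypergraph V) (k n : ℕ) (p μ α : ℝ) : Prop where
  isKGraph : H.IsKGraph k
  card_vertexSet : V(H).ncard = n
  isDense : H.IsDense k p μ
  minDegree : ∀ v ∈ V(H), α * (n.choose (k - 1) : ℝ) ≤ (H.vertexDegree v : ℝ)

/-- The map `f` embeds `F` into `H` as a (not necessarily induced) copy of `F`. -/
structure IsCopy {W V : Type*} (F : Hypergraph W) (H : Hypergraph V) (f : W → V) : Prop where
  injOn : Set.InjOn f V(F)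
  mapsTo : Set.MapsTo f V(F) V(H)
  map_edge : ∀ e ∈ E(F), f '' e ∈ E(H)

/-- `H` has a perfect `F`-packing: finitely many pairwise vertex-disjoint copies of `F` in `H`
which together cover the vertex set of `H`. -/
def HasPerfectPacking {W V : Type*} (F : Hypergraph W) (H : Hypergraph V) : Prop :=
  ∃ (m : ℕ) (f : Fin m → W → V),
    (∀ i, F.IsCopy H (f i)) ∧
    (∀ i j, i ≠ j → Disjoint (f i '' V(F)) (f j '' V(F))) ∧
    ⋃ i, f i '' V(F) = V(H)

/-- The cherry `K_{1,1,2}`: two triples sharing exactly two vertices. -/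
def cherry : Hypergraph (Fin 4) where
  vertexSet := Set.univ
  edgeSet := {{0, 1, 2}, {0, 1, 3}}
  subset_vertexSet_of_mem_edgeSet' := fun _ _ => Set.subset_univ _

/-- The 3-graph `C₄(2+1)` with edges `12a, 12b, 34a, 34b`; the vertices `1, 2, 3, 4, a, b` are
represented by `0, 1, 2, 3, 4, 5`. -/
def cycleFour : Hypergraph (Fin 6) where
  vertexSet := Set.univ
  edgeSet := {{0, 1, 4}, {0, 1, 5}, {2, 3, 4}, {2, 3, 5}}
  subset_vertexSet_of_mem_edgeSet' := fun _ _ => Set.subset_univ _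

end Hypergraph

/-! The proof is the absorption method, applied to the family of vertex sets of copies of the given
3-graph. All counts are probabilities over uniformly random tuples.

`exists_perfect_pack` isolates what is needed of a family of (k+1)-sets: (i) each vertex is
completed to a member by a positive proportion of k-tuples; (ii) for any two large sets A and A', a
positive proportion of tuples forms a member with one vertex in A' and the others in A.

Two vertices with many common completions (`Twins`) can be exchanged. By Cauchy–Schwarz almost all
vertices have many twins (`fr_few_twins`); by double counting, for almost all x, most pairs of twins
of x have many common twins (`fr_many_bad_pairs`) and so are exchangeable. If x and y are two such
vertices, (ii) supplies two members that agree up to exchangeable vertices, except that one contains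
a twin x' of x where the other contains a twin z of y. Hence x' and z are exchangeable
(`fr_reach_pairs`), and the chain x, x', z, y makes x and y exchangeable. Thus any two vertices
outside a small set B are exchangeable in many ways (`exists_exceptional_set`), so every (k+1)-set
outside B has many absorbers (`le_fr_absorbing`). Set aside a small disjoint family of absorbers,
cover B greedily, pack maximally; by (ii) the remainder is small, and it is absorbed.

Both 3-graphs arise by doubling one vertex: the cherry from an edge, C₄(2+1) from two edges meeting
in one vertex. Cauchy–Schwarz therefore reduces (i) and (ii) to counting the undoubled
configurations, by minimum degree and by denseness. -/

/-- The proportion of elements of a finite type that satisfy `P`. -/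
noncomputable def fr {α : Type*} (P : α → Prop) : ℝ := (Nat.card { a // P a } : ℝ) / Nat.card α

theorem fr_nonneg {α : Type*} (P : α → Prop) : 0 ≤ fr P := by unfold fr; positivity

/-- The map `f` sends the uniform distribution to the uniform distribution. -/
def Unif {α β : Type*} (f : α → β) : Prop := ∀ P : β → Prop, fr (fun a => P (f a)) = fr P

theorem Unif.comp {α β γ : Type*} {f : α → β} {g : β → γ} (hg : Unif g) (hf : Unif f) :
    Unif fun a => g (f a) := fun P => (hf fun b => P (g b)).trans (hg P)

/-! ### Finite probability: union bounds, independence, averaging. -/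

section Fraction

open Finset
open scoped Classical

variable {α β ι V : Type*} [Fintype α] [Fintype β] [Fintype ι] [Fintype V]

theorem fr_eq_card (P : α → Prop) [DecidablePred P] :
    fr P = ((univ.filter P).card : ℝ) / Fintype.card α := by
  rw [fr, Nat.card_eq_fintype_card, Nat.card_eq_fintype_card, Fintype.card_subtype]

theorem fr_le_one (P : α → Prop) : fr P ≤ 1 := by
  simp only [fr_eq_card]
  apply div_le_one_of_le₀ _ (by positivity)
  exact_mod_cast card_le_univ _

theorem fr_mono {P Q : α → Prop} (h : ∀ a, P a → Q a) : fr P ≤ fr Q := by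
  simp only [fr_eq_card]
  gcongr
  exact h _

theorem fr_congr {P Q : α → Prop} (h : ∀ a, P a ↔ Q a) : fr P = fr Q :=
  le_antisymm (fr_mono fun a => (h a).1) (fr_mono fun a => (h a).2)

theorem fr_false : fr (fun _ : α => False) = 0 := by simp [fr_eq_card]

theorem fr_true [Nonempty α] : fr (fun _ : α => True) = 1 := by
  simp [fr_eq_card]

theorem exists_of_fr_pos {P : α → Prop} (h : 0 < fr P) : ∃ a, P a := by
  by_contra! hn
  have : fr P = fr (fun _ : α => False) := fr_congr (by simpa using hn)
  rw [this, fr_false] at h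
  exact lt_irrefl _ h

theorem fr_or_le (P Q : α → Prop) : fr (fun a => P a ∨ Q a) ≤ fr P + fr Q := by
  simp only [fr_eq_card]
  rw [← add_div]
  gcongr
  rw [filter_or]
  exact_mod_cast card_union_le _ _

theorem fr_sub_le (P Q : α → Prop) : fr P - fr Q ≤ fr (fun a => P a ∧ ¬ Q a) := by
  have h := fr_or_le (fun a => P a ∧ ¬ Q a) Q
  have h2 : fr P ≤ fr (fun a => (P a ∧ ¬ Q a) ∨ Q a) := fr_mono fun a ha => by tauto
  linarith

theorem one_sub_le_fr_not [Nonempty α] (Q : α → Prop) : 1 - fr Q ≤ fr (fun a => ¬ Q a) := by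
  have h := fr_sub_le (fun _ => True) Q
  rw [fr_true] at h
  simpa using h

theorem fr_exists_le (P : ι → α → Prop) : fr (fun a => ∃ i, P i a) ≤ ∑ i, fr (P i) := by
  simp only [fr_eq_card]
  rw [← sum_div]
  gcongr
  have : (univ.filter fun a => ∃ i, P i a) = univ.biUnion fun i => univ.filter (P i) := by
    ext; simp
  rw [this]
  exact_mod_cast card_biUnion_le

theorem fr_mem (s : Finset α) : fr (fun a => a ∈ s) = (s.card : ℝ) / Nat.card α := by
  simp [fr_eq_card]

theorem fr_eq_const [Nonempty α] (b : α) : fr (fun a => a = b) = 1 / Nat.card α := by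
  rw [fr_eq_card, filter_eq' univ b]; simp

theorem fr_prod (P : α × β → Prop) :
    fr P = (∑ a, fr fun b => P (a, b)) / Fintype.card α := by
  simp only [fr_eq_card]
  rw [← sum_div, div_div, Fintype.card_prod]
  push_cast
  rw [mul_comm (Fintype.card α : ℝ)]
  congr 1
  simp only [card_filter]
  push_cast
  rw [Fintype.sum_prod_type]

theorem fr_equiv (e : α ≃ β) (P : β → Prop) : fr (fun a => P (e a)) = fr P := by
  simp only [fr_eq_card]
  rw [Fintype.card_congr e]
  congr 2
  refine card_bij (fun a _ => e a) (by simp) (by simp) ?_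
  intro b hb
  exact ⟨e.symm b, by simpa using hb, by simp⟩

theorem fr_swap (P : α × β → Prop) : fr (fun w : β × α => P (w.2, w.1)) = fr P :=
  fr_equiv (Equiv.prodComm β α) P

theorem sum_ite_div (P : α → Prop) [DecidablePred P] (b : ℝ) :
    (∑ a, if P a then b else 0) / Fintype.card α = fr P * b := by
  rw [← sum_filter, sum_const, nsmul_eq_mul, fr_eq_card]
  ring

theorem le_fr_prod {P : α → Prop} {Q : α → β → Prop} {b : ℝ}
    (h : ∀ a, P a → b ≤ fr (Q a)) : fr P * b ≤ fr (fun w : α × β => P w.1 ∧ Q w.1 w.2) := by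
  rw [fr_prod, ← sum_ite_div]
  gcongr with a
  by_cases ha : P a
  · simpa [ha] using h a ha
  · simp [ha, fr_nonneg]

theorem fr_prod_le {P : α → Prop} {Q : α → β → Prop} {b : ℝ}
    (h : ∀ a, P a → fr (Q a) ≤ b) : fr (fun w : α × β => P w.1 ∧ Q w.1 w.2) ≤ fr P * b := by
  rw [fr_prod, ← sum_ite_div]
  gcongr with a
  by_cases ha : P a
  · simpa [ha] using h a ha
  · simp [ha, fr_false]

theorem fr_prod_le' [Nonempty α] {Q : α → β → Prop} {b : ℝ}
    (h : ∀ a, fr (Q a) ≤ b) : fr (fun w : α × β => Q w.1 w.2) ≤ b := by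
  have := fr_prod_le (P := fun _ : α => True) (Q := Q) (b := b) (fun a _ => h a)
  rw [fr_true] at this
  simpa using this

theorem fr_prod_mul (P : α → Prop) (Q : β → Prop) :
    fr (fun w : α × β => P w.1 ∧ Q w.2) = fr P * fr Q :=
  le_antisymm (fr_prod_le (Q := fun _ => Q) fun _ _ => le_rfl)
    (le_fr_prod (Q := fun _ => Q) fun _ _ => le_rfl)

/-- Reverse Markov inequality. -/
theorem fr_markov {P : α × β → Prop} {t : ℝ} (h : t ≤ fr P) :
    t / 2 ≤ fr (fun a => t / 2 ≤ fr fun b => P (a, b)) := by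
  rcases le_or_gt t 0 with ht | ht
  · exact le_trans (by linarith) (fr_nonneg _)
  obtain ⟨w, -⟩ := exists_of_fr_pos (ht.trans_le h)
  have : Nonempty α := ⟨w.1⟩
  have h1 : fr P ≤ (∑ a, ((if t / 2 ≤ fr (fun b => P (a, b)) then (1 : ℝ) else 0) + t / 2)) /
      Fintype.card α := by
    rw [fr_prod]
    gcongr with a
    split_ifs with ha
    · have := fr_le_one fun b => P (a, b)
      linarith
    · linarith
  rw [sum_add_distrib, add_div, sum_ite_div, sum_const, nsmul_eq_mul, card_univ,
    mul_div_cancel_left₀ _ (by simp)] at h1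
  linarith

/-- The Cauchy–Schwarz inequality for doubling one coordinate. -/
theorem fr_sq_le (P : α → β → Prop) :
    (fr fun w : α × β => P w.1 w.2) ^ 2 ≤
      fr fun w : α × (β × β) => P w.1 w.2.1 ∧ P w.1 w.2.2 := by
  rw [fr_prod, fr_prod]
  simp only [fr_prod_mul, ← sq]
  rcases isEmpty_or_nonempty α with hα | hα
  · simp
  rw [div_pow, div_le_div_iff₀ (by positivity) (by positivity)]
  have := sq_sum_le_card_mul_sum_sq (s := univ) (f := fun a => fr (P a))
  rw [card_univ] at this
  calc _ ≤ (Fintype.card α * ∑ a, fr (P a) ^ 2) * (Fintype.card α : ℝ) := by gcongr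
    _ = _ := by ring

theorem le_fr_pi {X : ι → Type*} [∀ i, Fintype (X i)] (P : ∀ i, X i → Prop) :
    ∏ i, fr (P i) ≤ fr fun f : ∀ i, X i => ∀ i, P i (f i) := by
  simp only [fr_eq_card]
  rw [prod_div_distrib, Fintype.card_pi]
  push_cast
  gcongr
  rw [← Nat.cast_prod, ← Fintype.card_piFinset]
  apply Nat.cast_le.2
  apply card_le_card
  intro f hf
  simpa [Fintype.mem_piFinset] using hf

theorem unif_equiv (e : α ≃ β) : Unif e := fr_equiv e

theorem unif_fst [Nonempty β] : Unif (Prod.fst : α × β → α) := fun P => by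
  have := fr_prod_mul P (fun _ : β => True)
  rw [fr_true] at this
  simpa using this

theorem unif_eval [Nonempty V] (i : ι) : Unif (fun f : ι → V => f i) := fun P =>
  (fr_equiv (Equiv.funSplitAt i V) fun w => P w.1).trans (unif_fst P)

theorem Unif.prodMap {α' β' : Type*} [Fintype α'] [Fintype β'] {f : α → β} {g : α' → β'}
    (hf : Unif f) (hg : Unif g) : Unif (Prod.map f g) := fun P => by
  have h1 : fr (fun w : α × α' => P (Prod.map f g w)) = fr (fun w : α × β' => P (f w.1, w.2)) := by
    rw [fr_prod, fr_prod (fun w : α × β' => P (f w.1, w.2))]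
    congr 1
    exact sum_congr rfl fun a _ => hg fun b => P (f a, b)
  rw [h1, ← fr_swap, ← fr_swap P, fr_prod, fr_prod (fun w : β' × β => P (w.2, w.1))]
  congr 1
  exact sum_congr rfl fun a _ => hf fun b => P (b, a)

theorem fr_apply_eq_apply [Nonempty V] {i j : ι} (h : i ≠ j) :
    fr (fun f : ι → V => f i = f j) ≤ 1 / Nat.card V := by
  have h1 : Unif (Prod.map id fun g : { j // j ≠ i } → V => g ⟨j, h.symm⟩) :=
    (unif_equiv (Equiv.refl V)).prodMap (unif_eval _)
  have h2 := fr_equiv (Equiv.funSplitAt i V) fun w => w.1 = w.2 ⟨j, h.symm⟩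
  have h3 := h1 fun w => w.1 = w.2
  refine (h2.trans h3).trans_le ?_
  apply fr_prod_le' (Q := fun a b => a = b)
  intro a
  rw [← fr_eq_const a]
  exact fr_mono fun b hb => hb.symm

/-- Union bound over pairs of indices. Tuples with repetitions are thus negligible for large `V`, so
counts may ignore distinctness until the end. -/
theorem fr_not_injective [Nonempty V] :
    fr (fun f : ι → V => ¬ Function.Injective f) ≤
      (Nat.card ι : ℝ) ^ 2 / Nat.card V := by
  calc _ ≤ fr (fun f : ι → V => ∃ w : ι × ι, w.1 ≠ w.2 ∧ f w.1 = f w.2) := by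
        apply fr_mono
        intro f hf
        simp only [Function.Injective, not_forall] at hf
        obtain ⟨i, j, h, hij⟩ := hf
        exact ⟨(i, j), hij, h⟩
    _ ≤ ∑ w : ι × ι, fr (fun f : ι → V => w.1 ≠ w.2 ∧ f w.1 = f w.2) := fr_exists_le _
    _ ≤ ∑ w : ι × ι, 1 / (Nat.card V : ℝ) := by
        gcongr with w
        by_cases h : w.1 = w.2
        · simp [h, fr_false]
        · simpa [h] using fr_apply_eq_apply (V := V) h
    _ = _ := by simp; ring

theorem fr_exists_mem [Nonempty V] (s : Finset V) :
    fr (fun f : ι → V => ∃ i, f i ∈ s) ≤ Nat.card ι * s.card / Nat.card V := by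
  calc _ ≤ ∑ i : ι, fr (fun f : ι → V => f i ∈ s) := fr_exists_le _
    _ = _ := by
        have : ∀ i : ι, fr (fun f : ι → V => f i ∈ s) = s.card / Nat.card V := fun i => by
          rw [unif_eval i fun a => a ∈ s, fr_mem]
        simp [this]
        ring

end Fraction

/-! ### Packings and exchanges of vertices. -/

section Packing

open Finset

/-- `Pack F X` says that `X` is a disjoint union of members of the family `F`. -/
inductive Pack {V : Type*} [DecidableEq V] (F : Finset V → Prop) : Finset V → Prop
  | empty : Pack F ∅
  | union {X Y : Finset V} : F X → Pack F Y → Disjoint X Y → Pack F (X ∪ Y)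

namespace Pack

variable {V : Type*} [DecidableEq V] {F : Finset V → Prop}

theorem single {X : Finset V} (h : F X) : Pack F X := by
  simpa using Pack.union h Pack.empty (disjoint_empty_right X)

theorem disjUnion {X Y : Finset V} (hX : Pack F X) (hY : Pack F Y) (h : Disjoint X Y) :
    Pack F (X ∪ Y) := by
  induction hX with
  | empty => simpa using hY
  | @union A B hA hB hAB ih =>
    rw [disjoint_union_left] at h
    rw [union_assoc]
    exact Pack.union hA (ih h.2) (disjoint_union_right.2 ⟨hAB, h.1⟩)

theorem biUnion {ι : Type*} (s : Finset ι) (f : ι → Finset V) (hf : ∀ i ∈ s, Pack F (f i))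
    (hd : (s : Set ι).PairwiseDisjoint f) : Pack F (s.biUnion f) := by
  classical
  induction s using Finset.induction_on with
  | empty => simpa using Pack.empty
  | insert a s ha ih =>
    rw [biUnion_insert]
    apply disjUnion (hf a (by simp))
    · exact ih (fun i hi => hf i (by simp [hi])) (hd.subset (by simp))
    · rw [disjoint_biUnion_right]
      intro i hi
      exact hd (by simp) (by simp [hi]) (fun h => ha (h ▸ hi))

theorem dvd_card {m : ℕ} (hF : ∀ X, F X → X.card = m) {X : Finset V} (h : Pack F X) :
    m ∣ X.card := by
  induction h with
  | empty => simp
  | union hX _ hd ih =>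
    rw [card_union_of_disjoint hd, hF _ hX]
    exact dvd_add (dvd_refl m) ih

theorem family {κ ι : Type*} [Fintype κ] [Fintype ι] {a : κ → V} {T : κ × ι → V}
    (h : Function.Injective (Sum.elim a T))
    (hp : ∀ i, Pack F (insert (a i) (univ.image fun j => T (i, j)))) :
    Pack F (univ.image a ∪ univ.image T) := by
  have key := biUnion univ (fun i => insert (a i) (univ.image fun j => T (i, j)))
    (fun i _ => hp i) ?_
  · convert key using 1
    ext v
    simp only [mem_union, mem_image, mem_univ, true_and, mem_biUnion, mem_insert, Prod.exists]
    constructor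
    · rintro (⟨i, rfl⟩ | ⟨i, j, rfl⟩)
      · exact ⟨i, Or.inl rfl⟩
      · exact ⟨i, Or.inr ⟨j, rfl⟩⟩
    · rintro ⟨i, rfl | ⟨j, rfl⟩⟩
      · exact Or.inl ⟨i, rfl⟩
      · exact Or.inr ⟨i, j, rfl⟩
  · intro i _ i' _ hii
    simp only [Function.onFun]
    rw [disjoint_left]
    intro v hv hv'
    simp only [mem_image, mem_univ, true_and, mem_insert] at hv hv'
    apply hii
    rcases hv with rfl | ⟨j, rfl⟩ <;> rcases hv' with hv' | ⟨j', hv'⟩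
    · simpa using @h (.inl i) (.inl i') hv'
    · simpa using @h (.inr (i', j')) (.inl i) hv'
    · simpa using @h (.inr (i, j)) (.inl i') hv'
    · have := @h (.inr (i', j')) (.inr (i, j)) hv'
      simp only [Sum.inr.injEq, Prod.mk.injEq] at this
      exact this.1.symm

end Pack

/-- If the entries of `S` are distinct and different from `x` and `y`, then adding either of the
vertices `x`, `y` to `S` produces a set with a packing. -/
def Swaps {V ι : Type*} [DecidableEq V] [Fintype ι] (F : Finset V → Prop) (x y : V)
    (S : ι → V) : Prop :=
  Function.Injective S → (∀ i, S i ≠ x) → (∀ i, S i ≠ y) →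
    Pack F (insert x (univ.image S)) ∧ Pack F (insert y (univ.image S))

/-- At least the proportion `η` of all `S : ι → V` can be used to exchange `x` and `y`. -/
def Reach {V : Type*} [DecidableEq V] (F : Finset V → Prop) (ι : Type*) [Fintype ι] (η : ℝ)
    (x y : V) : Prop :=
  η ≤ fr fun S : ι → V => Swaps F x y S

variable {V : Type*} [DecidableEq V] {F : Finset V → Prop}

/-- The intermediate vertex joins the tuple: if `x` is present it goes with the first block and the
intermediate vertex with the second; if `y` is present, `y` takes the second block and the
intermediate vertex the first. -/
theorem Swaps.trans {ι κ : Type*} [Fintype ι] [Fintype κ] {x y : V} {S : (ι ⊕ κ) ⊕ Unit → V}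
    (h₁ : Swaps F x (S (.inr ())) fun i => S (.inl (.inl i)))
    (h₂ : Swaps F (S (.inr ())) y fun i => S (.inl (.inr i))) : Swaps F x y S := by
  intro hS hx hy
  obtain ⟨a₁, b₁⟩ := h₁ (fun i j h => by simpa using hS h) (fun i => hx _)
    (fun i h => by simpa using hS h)
  obtain ⟨a₂, b₂⟩ := h₂ (fun i j h => by simpa using hS h) (fun i h => by simpa using hS h)
    (fun i => hy _)
  constructor
  · convert a₁.disjUnion a₂ ?_ using 1
    · ext v
      simp only [mem_insert, mem_image, mem_univ, true_and, mem_union, Sum.exists]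
      constructor
      · rintro (rfl | (⟨i, rfl⟩ | ⟨i, rfl⟩) | ⟨⟨⟩, rfl⟩) <;> simp
      · rintro ((rfl | ⟨i, rfl⟩) | (rfl | ⟨i, rfl⟩)) <;> simp
    · rw [disjoint_left]
      intro v hv hv'
      simp only [mem_image, mem_univ, true_and, mem_insert] at hv hv'
      rcases hv with rfl | ⟨j, rfl⟩ <;> rcases hv' with hv' | ⟨j', hv'⟩
      · exact hx _ hv'.symm
      · exact hx _ hv'
      · simpa using hS hv'
      · simpa using hS hv'
  · convert b₁.disjUnion b₂ ?_ using 1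
    · ext v
      simp only [mem_insert, mem_image, mem_univ, true_and, mem_union, Sum.exists]
      constructor
      · rintro (rfl | (⟨i, rfl⟩ | ⟨i, rfl⟩) | ⟨⟨⟩, rfl⟩) <;> simp
      · rintro ((rfl | ⟨i, rfl⟩) | (rfl | ⟨i, rfl⟩)) <;> simp
    · rw [disjoint_left]
      intro v hv hv'
      simp only [mem_image, mem_univ, true_and, mem_insert] at hv hv'
      rcases hv with rfl | ⟨j, rfl⟩ <;> rcases hv' with hv' | ⟨j', hv'⟩
      · exact hy _ hv'
      · simpa using hS hv'
      · exact hy _ hv'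
      · simpa using hS hv'

/-- Two members `u ∪ {z}` and `v ∪ {x}` of `F` together with exchanges of `u i` and `v i` give an
exchange of `x` and `z`. -/
theorem Swaps.exchange {ι κ : Type*} [Fintype ι] [Fintype κ] {x z : V}
    {S : (κ ⊕ κ) ⊕ (κ × ι) → V}
    (hu : F (insert z (univ.image fun i => S (.inl (.inl i)))))
    (hv : F (insert x (univ.image fun i => S (.inl (.inr i)))))
    (h : ∀ i, Swaps F (S (.inl (.inl i))) (S (.inl (.inr i))) fun j => S (.inr (i, j))) :
    Swaps F x z S := by
  intro hS hx hz
  have hT := fun i => h i (fun j j' h => by simpa using hS h) (fun j h => by simpa using hS h)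
    (fun j h => by simpa using hS h)
  have pu : Pack F _ := Pack.family (a := fun i => S (.inl (.inl i))) (T := fun w => S (.inr w))
    (by rintro (i | i) (j | j) h <;> simpa using hS h) fun i => (hT i).1
  have pv : Pack F _ := Pack.family (a := fun i => S (.inl (.inr i))) (T := fun w => S (.inr w))
    (by rintro (i | i) (j | j) h <;> simpa using hS h) fun i => (hT i).2
  constructor
  · convert Pack.union hv pu ?_ using 1
    · ext v
      simp only [mem_insert, mem_image, mem_univ, true_and, mem_union, Sum.exists]
      tauto
    · rw [disjoint_left]
      intro v hv hv'
      simp only [mem_image, mem_univ, true_and, mem_insert, mem_union] at hv hv'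
      rcases hv with rfl | ⟨j, rfl⟩ <;> rcases hv' with ⟨j', hv'⟩ | ⟨j', hv'⟩
      · exact hx _ hv'
      · exact hx _ hv'
      · simpa using hS hv'
      · simpa using hS hv'
  · convert Pack.union hu pv ?_ using 1
    · ext v
      simp only [mem_insert, mem_image, mem_univ, true_and, mem_union, Sum.exists]
      tauto
    · rw [disjoint_left]
      intro v hv hv'
      simp only [mem_image, mem_univ, true_and, mem_insert, mem_union] at hv hv'
      rcases hv with rfl | ⟨j, rfl⟩ <;> rcases hv' with ⟨j', hv'⟩ | ⟨j', hv'⟩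
      · exact hz _ hv'
      · exact hz _ hv'
      · simpa using hS hv'
      · simpa using hS hv'

variable [Fintype V]

theorem Reach.of_common {ι : Type*} [Fintype ι] {η : ℝ} {x y : V}
    (h : η ≤ fr fun S : ι → V => F (insert x (univ.image S)) ∧ F (insert y (univ.image S))) :
    Reach F ι η x y := by
  classical
  exact h.trans <| fr_mono fun S hS _ _ _ => ⟨Pack.single hS.1, Pack.single hS.2⟩

theorem Reach.trans {ι κ : Type*} [Fintype ι] [Fintype κ] {ε η η' : ℝ} {x y : V}
    (hη : 0 ≤ η) (hη' : 0 ≤ η')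
    (h : ε ≤ fr fun w => Reach F ι η x w ∧ Reach F κ η' w y) :
    Reach F ((ι ⊕ κ) ⊕ Unit) (ε * (η * η')) x y := by
  classical
  have h1 := le_fr_prod (P := fun w => Reach F ι η x w ∧ Reach F κ η' w y)
    (Q := fun w (T : (ι → V) × (κ → V)) => Swaps F x w T.1 ∧ Swaps F w y T.2)
    (b := η * η') (fun w hw => by
      rw [fr_prod_mul]
      exact mul_le_mul hw.1 hw.2 hη' (fr_nonneg _))
  let e : ((ι ⊕ κ) ⊕ Unit → V) ≃ V × ((ι → V) × (κ → V)) :=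
    { toFun := fun S => (S (.inr ()), fun i => S (.inl (.inl i)), fun i => S (.inl (.inr i)))
      invFun := fun w => Sum.elim (Sum.elim w.2.1 w.2.2) fun _ => w.1
      left_inv := fun S => by ext ((i | i) | i) <;> rfl
      right_inv := fun w => rfl }
  rw [← fr_equiv e] at h1
  refine (mul_le_mul_of_nonneg_right h (by positivity)).trans (h1.trans (fr_mono ?_))
  exact fun S hS => hS.2.1.trans hS.2.2

/-- Draw the two members of `Swaps.exchange` independently, one with its last vertex in `A'`, the
other inside `A`. Their remaining vertices all lie in `A`, so by a union bound over `κ` at least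
half of the product bound `θ ^ 2` survives the requirement that corresponding vertices be
exchangeable. Filling in exchanging tuples and regrouping coordinates, reverse Markov passes to
pairs with many exchanges. -/
theorem fr_reach_pairs {ι κ : Type*} [Fintype ι] [Fintype κ] {A A' : V → Prop} {θ ε η : ℝ}
    (hθ : 0 < θ) (hη : 0 < η)
    (h₁ : θ ≤ fr fun w : (κ → V) × V =>
      (∀ i, A (w.1 i)) ∧ A' w.2 ∧ F (insert w.2 (univ.image w.1)))
    (h₂ : θ ≤ fr fun w : (κ → V) × V =>
      (∀ i, A (w.1 i)) ∧ A w.2 ∧ F (insert w.2 (univ.image w.1)))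
    (hbad : fr (fun w : V × V => A w.1 ∧ A w.2 ∧ ¬ Reach F ι η w.1 w.2) ≤ ε)
    (hε : Fintype.card κ * ε ≤ θ ^ 2 / 2) :
    θ ^ 2 / 2 * η ^ Fintype.card κ / 2 ≤ fr fun w : V × V => A' w.1 ∧ A w.2 ∧
      Reach F ((κ ⊕ κ) ⊕ (κ × ι)) (θ ^ 2 / 2 * η ^ Fintype.card κ / 2) w.2 w.1 := by
  classical
  obtain ⟨w₀, -⟩ := exists_of_fr_pos (hθ.trans_le h₁)
  have : Nonempty V := ⟨w₀.2⟩
  set P₁ := fun w : (κ → V) × V =>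
      (∀ i, A (w.1 i)) ∧ A' w.2 ∧ F (insert w.2 (univ.image w.1)) with hP₁
  set P₂ := fun w : (κ → V) × V =>
      (∀ i, A (w.1 i)) ∧ A w.2 ∧ F (insert w.2 (univ.image w.1)) with hP₂
  have hprod : θ ^ 2 ≤ fr fun w : ((κ → V) × V) × ((κ → V) × V) => P₁ w.1 ∧ P₂ w.2 := by
    rw [fr_prod_mul, sq]
    exact mul_le_mul h₁ h₂ hθ.le (fr_nonneg _)
  have hex : fr (fun w : ((κ → V) × V) × ((κ → V) × V) =>
      ∃ i, A (w.1.1 i) ∧ A (w.2.1 i) ∧ ¬ Reach F ι η (w.1.1 i) (w.2.1 i)) ≤ θ ^ 2 / 2 := by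
    refine (fr_exists_le _).trans ?_
    calc _ ≤ ∑ i : κ, ε := by
          gcongr with i
          have hu : Unif fun w : (κ → V) × V => w.1 i := (unif_eval i).comp unif_fst
          exact ((hu.prodMap hu) fun w => A w.1 ∧ A w.2 ∧ ¬ Reach F ι η w.1 w.2).trans_le hbad
      _ = Fintype.card κ * ε := by simp
      _ ≤ _ := hε
  have hconf := fr_sub_le (fun w : ((κ → V) × V) × ((κ → V) × V) => P₁ w.1 ∧ P₂ w.2)
    (fun w => ∃ i, A (w.1.1 i) ∧ A (w.2.1 i) ∧ ¬ Reach F ι η (w.1.1 i) (w.2.1 i))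
  have hT := le_fr_prod (P := fun w : ((κ → V) × V) × ((κ → V) × V) => (P₁ w.1 ∧ P₂ w.2) ∧
      ¬ ∃ i, A (w.1.1 i) ∧ A (w.2.1 i) ∧ ¬ Reach F ι η (w.1.1 i) (w.2.1 i))
    (Q := fun w (T : κ → ι → V) => ∀ i, Swaps F (w.1.1 i) (w.2.1 i) (T i))
    (b := η ^ Fintype.card κ) (fun w hw => by
      refine le_trans ?_ (le_fr_pi _)
      rw [← card_univ, ← prod_const]
      apply prod_le_prod (fun _ _ => hη.le)
      intro i _
      by_contra hcon
      exact hw.2 ⟨i, hw.1.1.1 i, hw.1.2.1 i, hcon⟩)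
  let e : (V × V) × ((κ ⊕ κ) ⊕ (κ × ι) → V) ≃
      (((κ → V) × V) × ((κ → V) × V)) × (κ → ι → V) :=
    { toFun := fun w => (((fun i => w.2 (.inl (.inl i)), w.1.1),
        (fun i => w.2 (.inl (.inr i)), w.1.2)), fun i j => w.2 (.inr (i, j)))
      invFun := fun w => ((w.1.1.2, w.1.2.2),
        Sum.elim (Sum.elim w.1.1.1 w.1.2.1) fun t => w.2 t.1 t.2)
      left_inv := fun w => by
        ext i
        · rfl
        · rfl
        · rcases i with (i | i) | i <;> rfl
      right_inv := fun w => rfl }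
  rw [← fr_equiv e] at hT
  have hlow : θ ^ 2 / 2 * η ^ Fintype.card κ ≤ fr fun w : (V × V) × ((κ ⊕ κ) ⊕ (κ × ι) → V) =>
      A' w.1.1 ∧ A w.1.2 ∧ Swaps F w.1.2 w.1.1 w.2 := by
    refine le_trans ?_ (hT.trans (fr_mono ?_))
    · gcongr
      linarith
    · rintro w ⟨⟨⟨h1, h2⟩, -⟩, h3⟩
      exact ⟨h1.2.1, h2.2.1, Swaps.exchange h1.2.2 h2.2.2 h3⟩
  refine (fr_markov hlow).trans (fr_mono ?_)
  intro w hw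
  obtain ⟨S, hS⟩ := exists_of_fr_pos (lt_of_lt_of_le (by positivity) hw)
  exact ⟨hS.1, hS.2.1, hw.trans (fr_mono fun S hS => hS.2.2)⟩

end Packing

/-! ### Exchangeable vertices and absorbers. -/

section Absorption

open Finset

/-- Double counting of triples `(x, w)`: a pair `w` with few common neighbours is, by definition,
seen by few `x`. -/
theorem fr_many_bad_pairs {V : Type*} [Fintype V] {R : V → V → Prop} (hR : ∀ x y, R x y → R y x) {ε ε' : ℝ}
    (hε : 0 ≤ ε) (hε' : 0 < ε') :
    fr (fun x => ε' < fr fun w : V × V => R x w.1 ∧ R x w.2 ∧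
      fr (fun z => R w.1 z ∧ R z w.2) < ε) ≤ ε / ε' := by
  rw [le_div_iff₀ hε']
  have h1 := le_fr_prod (P := fun x => ε' < fr fun w : V × V => R x w.1 ∧ R x w.2 ∧
      fr (fun z => R w.1 z ∧ R z w.2) < ε)
    (Q := fun x (w : V × V) => R x w.1 ∧ R x w.2 ∧ fr (fun z => R w.1 z ∧ R z w.2) < ε)
    (b := ε') fun x hx => hx.le
  have h2 := fr_prod_le (P := fun w : V × V => fr (fun z => R w.1 z ∧ R z w.2) < ε)
    (Q := fun w z => R w.1 z ∧ R z w.2) (b := ε) fun w hw => hw.le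
  refine h1.trans ?_
  rw [← fr_swap]
  refine le_trans (fr_mono ?_) (h2.trans (mul_le_of_le_one_left hε (fr_le_one _)))
  rintro w ⟨-, a, b, c⟩
  exact ⟨c, hR _ _ a, b⟩

variable {V : Type*} [DecidableEq V] {F : Finset V → Prop}

/-- At least the proportion `γ` of all `S : κ → V` complete both `x` and `y` to a member of `F`. -/
def Twins (F : Finset V → Prop) (κ : Type*) [Fintype κ] (γ : ℝ) (x y : V) : Prop :=
  γ ≤ fr fun S : κ → V => F (insert x (univ.image S)) ∧ F (insert y (univ.image S))

theorem Twins.symm {κ : Type*} [Fintype κ] {γ : ℝ} {x y : V} (h : Twins F κ γ x y) :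
    Twins F κ γ y x := by
  unfold Twins at *
  simpa only [and_comm] using h

/-- Let `B` be the vertices with few twins. Cauchy–Schwarz over the completions `S` gives at least
`(fr B * c) ^ 2` triples of two vertices of `B` with a common completion. Twin pairs contribute at
most `fr B * δ`, the other pairs at most half of the total, which bounds `fr B`. -/
theorem fr_few_twins [Fintype V] [Nonempty V] {κ : Type*} [Fintype κ] {c δ : ℝ} (hc : 0 < c)
    (hδ : 0 ≤ δ) (h : ∀ x, c ≤ fr fun S : κ → V => F (insert x (univ.image S))) :
    fr (fun x => fr (Twins F κ (c ^ 2 / 2) x) < δ) ≤ 2 * δ / c ^ 2 := by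
  classical
  set B := fun x => fr (Twins F κ (c ^ 2 / 2) x) < δ with hB
  set g := fun (S : κ → V) x => B x ∧ F (insert x (univ.image S)) with hg
  have h1 : fr B * c ≤ fr fun w : (κ → V) × V => g w.1 w.2 := by
    have h := le_fr_prod (P := B) (Q := fun x (S : κ → V) => F (insert x (univ.image S)))
      fun x _ => h x
    exact h.trans_eq (fr_swap fun w : (κ → V) × V => g w.1 w.2)
  have h2 := fr_sq_le g
  rw [← fr_swap fun w : (κ → V) × (V × V) => g w.1 w.2.1 ∧ g w.1 w.2.2] at h2
  have h3 : fr (fun w : (V × V) × (κ → V) => g w.2 w.1.1 ∧ g w.2 w.1.2) ≤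
      fr (fun w : (V × V) × (κ → V) => B w.1.1 ∧ Twins F κ (c ^ 2 / 2) w.1.1 w.1.2) +
      fr (fun w : (V × V) × (κ → V) => ((B w.1.1 ∧ B w.1.2) ∧
        ¬ Twins F κ (c ^ 2 / 2) w.1.1 w.1.2) ∧
        (F (insert w.1.1 (univ.image w.2)) ∧ F (insert w.1.2 (univ.image w.2)))) := by
    refine le_trans (fr_mono ?_) (fr_or_le _ _)
    rintro w ⟨⟨a1, a2⟩, a3, a4⟩
    tauto
  have h4 : fr (fun w : (V × V) × (κ → V) => B w.1.1 ∧ Twins F κ (c ^ 2 / 2) w.1.1 w.1.2) ≤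
      fr B * δ := by
    rw [unif_fst fun w : V × V => B w.1 ∧ Twins F κ (c ^ 2 / 2) w.1 w.2]
    exact fr_prod_le fun x hx => hx.le
  have h5 : fr (fun w : (V × V) × (κ → V) => ((B w.1.1 ∧ B w.1.2) ∧
        ¬ Twins F κ (c ^ 2 / 2) w.1.1 w.1.2) ∧
        (F (insert w.1.1 (univ.image w.2)) ∧ F (insert w.1.2 (univ.image w.2)))) ≤
      fr B * fr B * (c ^ 2 / 2) := by
    refine (fr_prod_le (P := fun w : V × V => (B w.1 ∧ B w.2) ∧
        ¬ Twins F κ (c ^ 2 / 2) w.1 w.2)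
      (Q := fun w (S : κ → V) => F (insert w.1 (univ.image S)) ∧ F (insert w.2 (univ.image S)))
      (b := c ^ 2 / 2) fun w hw => (not_le.1 hw.2).le).trans ?_
    gcongr
    rw [← fr_prod_mul]
    exact fr_mono fun w hw => hw.1
  have h0 := fr_nonneg B
  rcases h0.eq_or_lt with h0 | h0
  · rw [← h0]; positivity
  have h6 : (fr B * c) ^ 2 ≤ fr B * δ + fr B * fr B * (c ^ 2 / 2) := by
    calc (fr B * c) ^ 2 ≤ _ := pow_le_pow_left₀ (by positivity) h1 2
      _ ≤ _ := h2
      _ ≤ _ := h3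
      _ ≤ _ := add_le_add h4 h5
  rw [le_div_iff₀ (by positivity)]
  have h7 : fr B * (fr B * c ^ 2) ≤ fr B * (2 * δ) := by nlinarith
  exact le_of_mul_le_mul_left h7 h0

/-- The index type of the tuples exchanging two vertices outside the exceptional set. -/
abbrev SwapIndex (κ : Type*) :=
  ((κ ⊕ ((κ ⊕ κ) ⊕ (κ × ((κ ⊕ κ) ⊕ Unit)))) ⊕ Unit) ⊕ κ

/-- The exceptional vertices have few twins or too many pairs of twins that lack common twins. For
two other vertices `x`, `y`, apply `fr_reach_pairs` to their twin sets and extend by a twin step at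
each end. -/
theorem exists_exceptional_set (κ : Type) [Fintype κ] {c : ℝ} (hc : 0 < c) (c₂ : ℝ → ℝ)
    (hc₂ : ∀ δ, 0 < δ → 0 < c₂ δ) {σ : ℝ} (hσ : 0 < σ) :
    ∃ δ > 0, ∃ η > 0, ∀ (V : Type*) [Fintype V] [DecidableEq V] [Nonempty V]
      (F : Finset V → Prop),
      (∀ x, c ≤ fr fun S : κ → V => F (insert x (univ.image S))) →
      (∀ A A' : V → Prop, δ ≤ fr A → δ ≤ fr A' → c₂ δ ≤ fr fun w : (κ → V) × V =>
        (∀ i, A (w.1 i)) ∧ A' w.2 ∧ F (insert w.2 (univ.image w.1))) →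
      ∃ B : V → Prop, fr B ≤ σ ∧
        ∀ x y, ¬ B x → ¬ B y → Reach F (SwapIndex κ ⊕ Unit) η x y := by
  set γ := c ^ 2 / 2 with hγ
  have hγ0 : 0 < γ := by positivity
  -- With this `δ` and with `ε / ε' = σ / 2`, each of the two kinds of exceptional vertices has
  -- proportion at most `σ / 2`; `ε'` is small enough for the union bound over `κ`.
  set δ := σ * c ^ 2 / 4 with hδ
  have hδ0 : 0 < δ := by positivity
  set θ := c₂ δ with hθ
  have hθ0 : 0 < θ := hc₂ δ hδ0
  set ε' := θ ^ 2 / (2 * (Fintype.card κ + 1)) with hε'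
  have hε'0 : 0 < ε' := by positivity
  set ε := ε' * σ / 2 with hε
  have hε0 : 0 < ε := by positivity
  set ζ := θ ^ 2 / 2 * (ε * (γ * γ)) ^ Fintype.card κ / 2 with hζ
  have hζ0 : 0 < ζ := by positivity
  refine ⟨δ, hδ0, ζ / 2 * (ζ / 2 * (γ * ζ) * γ), by positivity, ?_⟩
  intro V _ _ _ F h1 h2
  set R := Twins F κ γ with hR
  set bad := fun x => ε' < fr fun w : V × V => R x w.1 ∧ R x w.2 ∧
      fr (fun z => R w.1 z ∧ R z w.2) < ε with hbad
  refine ⟨fun x => fr (R x) < δ ∨ bad x, ?_, ?_⟩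
  · refine (fr_or_le _ _).trans ?_
    have e1 := fr_few_twins (κ := κ) hc hδ0.le h1
    have e2 := fr_many_bad_pairs (R := R) (fun x y h => h.symm) hε0.le hε'0
    have e3 : 2 * δ / c ^ 2 = σ / 2 := by rw [hδ]; field_simp; ring
    have e4 : ε / ε' = σ / 2 := by rw [hε]; field_simp
    linarith
  · intro x y hx hy
    simp only [not_or, not_lt, hbad] at hx hy
    have key := fr_reach_pairs (F := F) (ι := (κ ⊕ κ) ⊕ Unit) (κ := κ) (A := R x) (A' := R y)
      (θ := θ) (ε := ε') (η := ε * (γ * γ)) hθ0 (by positivity) (h2 _ _ hx.1 hy.1)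
      (h2 _ _ hx.1 hx.1) (by
        refine le_trans (fr_mono ?_) hx.2
        rintro w ⟨a, b, hw⟩
        refine ⟨a, b, ?_⟩
        by_contra hcon
        rw [not_lt] at hcon
        exact hw (Reach.trans hγ0.le hγ0.le (hcon.trans
          (fr_mono fun z hz => ⟨Reach.of_common hz.1, Reach.of_common hz.2⟩)))) (by
        rw [hε', ← mul_div_assoc, div_le_div_iff₀ (by positivity) (by positivity)]
        have := sq_nonneg θ
        nlinarith)
    have key2 := fr_markov key
    refine Reach.trans (by positivity) hγ0.le (key2.trans (fr_mono ?_))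
    intro z hz
    obtain ⟨v, hv⟩ := exists_of_fr_pos (lt_of_lt_of_le (by positivity) hz)
    refine ⟨Reach.trans hγ0.le hζ0.le (hz.trans (fr_mono ?_)), Reach.of_common hv.1.symm⟩
    exact fun v hv => ⟨Reach.of_common hv.2.1, hv.2.2⟩

/-- `X` absorbs `Q`: both `X` and `X ∪ Q` have a packing. -/
def Absorbing (F : Finset V → Prop) (Q X : Finset V) : Prop :=
  Pack F X ∧ Disjoint X Q ∧ Pack F (X ∪ Q)

/-- Without `Q`, each exchanging tuple is packed with its vertex `A (.inl j)`. With `Q`, it takes `Q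
j` instead, and the released vertices form one member of `F`. -/
theorem absorbing_of_swaps {J ι : Type*} [Fintype J] [Fintype ι] {Q : J → V}
    {A : J ⊕ (J × ι) → V} (hQ : Function.Injective Q) (hA : Function.Injective A)
    (hd : ∀ i j, A i ≠ Q j) (hy : F (univ.image fun j => A (.inl j)))
    (hs : ∀ j, Swaps F (Q j) (A (.inl j)) fun i => A (.inr (j, i))) :
    Absorbing F (univ.image Q) (univ.image A) := by
  have hT := fun j => hs j (fun i i' h => by simpa using hA h) (fun i => hd _ _)
    (fun i h => by simpa using hA h)
  have p₁ : Pack F _ := Pack.family (a := fun j => A (.inl j)) (T := fun w => A (.inr w))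
    (by rintro (i | i) (j | j) h <;> simpa using hA h) fun i => (hT i).2
  have p₂ : Pack F _ := Pack.family (a := Q) (T := fun w => A (.inr w))
    (by
      rintro (i | i) (j | j) h
      · simpa using hQ h
      · exact (hd _ _ h.symm).elim
      · exact (hd _ _ h).elim
      · simpa using hA h) fun i => (hT i).1
  refine ⟨?_, ?_, ?_⟩
  · convert p₁ using 1
    ext v
    simp only [mem_image, mem_univ, true_and, mem_union, Sum.exists]
  · rw [disjoint_left]
    intro v hv hv'
    simp only [mem_image, mem_univ, true_and] at hv hv'
    obtain ⟨i, rfl⟩ := hv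
    obtain ⟨j, hj⟩ := hv'
    exact hd _ _ hj.symm
  · convert Pack.union hy p₂ ?_ using 1
    · ext v
      simp only [mem_image, mem_univ, true_and, mem_union, Sum.exists]
      tauto
    · rw [disjoint_left]
      intro v hv hv'
      simp only [mem_image, mem_univ, true_and, mem_union] at hv hv'
      obtain ⟨i, rfl⟩ := hv
      rcases hv' with ⟨j, hj⟩ | ⟨j, hj⟩
      · exact hd _ _ hj.symm
      · simpa using hA hj

/-- Choose a member of `F` outside `B`, then independently an exchanging tuple for each of its
vertices. The subtracted term pays for tuples with repetitions or meeting `Q`. -/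
theorem le_fr_absorbing [Fintype V] [Nonempty V] {J ι : Type*} [Fintype J] [Fintype ι]
    {B : V → Prop} {θ η : ℝ} (hη : 0 ≤ η)
    (hB : ∀ x y, ¬ B x → ¬ B y → Reach F ι η x y)
    (hF : θ ≤ fr fun y : J → V => (∀ j, ¬ B (y j)) ∧ F (univ.image y))
    {Q : J → V} (hQ : Function.Injective Q) (hQB : ∀ j, ¬ B (Q j)) :
    θ * η ^ Fintype.card J - ((Nat.card (J ⊕ J × ι) : ℝ) ^ 2 +
        Nat.card (J ⊕ J × ι) * Nat.card J) / Nat.card V ≤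
      fr fun A : J ⊕ (J × ι) → V => Absorbing F (univ.image Q) (univ.image A) := by
  classical
  have h1 := le_fr_prod (P := fun y : J → V => (∀ j, ¬ B (y j)) ∧ F (univ.image y))
    (Q := fun y (T : J → ι → V) => ∀ j, Swaps F (Q j) (y j) (T j)) (b := η ^ Fintype.card J)
    (fun y hy => by
      refine le_trans ?_ (le_fr_pi _)
      rw [← card_univ, ← prod_const]
      exact prod_le_prod (fun _ _ => hη) fun j _ => hB _ _ (hQB j) (hy.1 j))
  let e : (J ⊕ (J × ι) → V) ≃ (J → V) × (J → ι → V) :=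
    { toFun := fun S => (fun i => S (.inl i), fun i j => S (.inr (i, j)))
      invFun := fun w => Sum.elim w.1 fun t => w.2 t.1 t.2
      left_inv := fun S => by ext (i | i) <;> rfl
      right_inv := fun w => rfl }
  rw [← fr_equiv e] at h1
  have h2 := (fr_or_le (fun f : J ⊕ (J × ι) → V => ¬ Function.Injective f)
    fun f => ∃ i, f i ∈ univ.image Q).trans
    (add_le_add fr_not_injective (fr_exists_mem (univ.image Q)))
  rw [card_image_of_injective _ hQ, card_univ, ← Nat.card_eq_fintype_card, ← add_div] at h2
  have h3 := mul_le_mul_of_nonneg_right hF (pow_nonneg hη (Fintype.card J))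
  refine (sub_le_sub (h3.trans h1) h2).trans ((fr_sub_le _ _).trans (fr_mono ?_))
  rintro A ⟨⟨hy, hs⟩, hA⟩
  simp only [not_or, not_not, not_exists] at hA
  exact absorbing_of_swaps hQ hA.1 (fun i j h => hA.2 i (by simp [h])) hy.2 hs

/-- Members of a dense family can be chosen disjointly so that every index `i` is served often; this
derandomizes a random choice by means of the weights `2 ^ (-count)`. -/
theorem exists_disjoint_family [Fintype V] [Nonempty V] {I κ : Type*} [Fintype I] [Fintype κ]
    [Nonempty κ] (G : I → Finset V → Prop) [∀ i, DecidablePred (G i)] {η : ℝ} (hη : 0 < η)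
    (hη1 : η ≤ 1)
    (hG : ∀ i, η ≤ fr fun f : κ → V => G i (univ.image f)) {T : ℕ}
    (hT : (Fintype.card κ : ℝ) * (Fintype.card κ * T) / Nat.card V ≤ η / 2) :
    ∀ t ≤ T, ∃ 𝒢 : Finset (Finset V), (∀ X ∈ 𝒢, ∃ i, G i X) ∧ (∀ X ∈ 𝒢, X.card ≤ Fintype.card κ) ∧
      (𝒢 : Set (Finset V)).PairwiseDisjoint id ∧ 𝒢.card ≤ t ∧
      ∑ i, (1 / 2 : ℝ) ^ (𝒢.filter (G i)).card ≤ Fintype.card I * (1 - η / 4) ^ t := by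
  classical
  intro t
  induction t with
  | zero => intro _; exact ⟨∅, by simp⟩
  | succ t ih =>
    intro ht
    obtain ⟨𝒢, hGi, hcard, hdisj, ht𝒢, hsum⟩ := ih (by omega)
    rcases isEmpty_or_nonempty I with hI | hI
    · exact ⟨𝒢, hGi, hcard, hdisj, by omega, by simp⟩
    set R := 𝒢.biUnion id with hRdef
    have hR : (R.card : ℝ) ≤ Fintype.card κ * T := by
      have : R.card ≤ 𝒢.card * Fintype.card κ := card_biUnion_le_card_mul _ _ _ hcard
      have h2 : 𝒢.card * Fintype.card κ ≤ T * Fintype.card κ := by gcongr; omega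
      rw [mul_comm (Fintype.card κ : ℝ)]
      exact_mod_cast this.trans h2
    have havoid : ∀ i, η / 2 ≤ fr fun f : κ → V =>
        G i (univ.image f) ∧ ¬ ∃ j, f j ∈ R := by
      intro i
      have h1 := fr_sub_le (fun f : κ → V => G i (univ.image f)) fun f => ∃ j, f j ∈ R
      have h2 := fr_exists_mem (ι := κ) R
      have h3 : (Nat.card κ : ℝ) * R.card / Nat.card V ≤ η / 2 := by
        refine le_trans ?_ hT
        rw [Nat.card_eq_fintype_card (α := κ)]
        gcongr
      have h4 := hG i
      linarith
    set w : I → ℝ := fun i => (1 / 2 : ℝ) ^ (𝒢.filter (G i)).card with hw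
    have hw0 : ∀ i, 0 < w i := fun i => by positivity
    set Φ := ∑ i, w i with hΦ
    have hΦ0 : 0 < Φ := sum_pos (fun i _ => hw0 i) univ_nonempty
    set P : I → (κ → V) → Prop := fun i f => G i (univ.image f) ∧ ¬ ∃ j, f j ∈ R with hP
    -- Averaging over `f`: each index is served with probability at least `η / 2`, so some `f`
    -- serves at least that share of the total weight. Halving the served weights shrinks `Φ` by the
    -- factor `1 - η / 4`.
    obtain ⟨f, hf⟩ : ∃ f : κ → V, η / 2 * Φ ≤ ∑ i, if P i f then w i else 0 := by
      by_contra! hcon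
      have h1 : ∑ f : κ → V, (∑ i, if P i f then w i else 0) < ∑ f : κ → V, η / 2 * Φ :=
        sum_lt_sum_of_nonempty univ_nonempty fun f _ => hcon f
      rw [sum_comm, sum_const, nsmul_eq_mul, card_univ] at h1
      have h2 : ∀ i, (Fintype.card (κ → V) : ℝ) * (η / 2 * w i) ≤
          ∑ f : κ → V, if P i f then w i else 0 := by
        intro i
        have h3 := sum_ite_div (P i) (w i)
        rw [div_eq_iff (by simp)] at h3
        rw [h3, mul_comm]
        have h5 := hw0 i
        have := havoid i
        gcongr
      have h4 := sum_le_sum fun i (_ : i ∈ (univ : Finset I)) => h2 i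
      rw [← mul_sum, ← mul_sum] at h4
      linarith
    set X := univ.image f with hX
    obtain ⟨i₀, hi₀⟩ : ∃ i, P i f := by
      by_contra! hcon
      simp only [hcon, if_false, sum_const_zero] at hf
      nlinarith
    have hXR : Disjoint X R := by
      rw [disjoint_left]
      intro v hv hvR
      simp only [hX, mem_image, mem_univ, true_and] at hv
      obtain ⟨j, rfl⟩ := hv
      exact hi₀.2 ⟨j, hvR⟩
    have hX0 : X.Nonempty := univ_nonempty.image f
    have hX𝒢 : X ∉ 𝒢 := by
      intro hmem
      obtain ⟨v, hv⟩ := hX0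
      exact disjoint_left.1 hXR hv (mem_biUnion.2 ⟨X, hmem, hv⟩)
    refine ⟨insert X 𝒢, ?_, ?_, ?_, ?_, ?_⟩
    · intro Y hY
      rcases mem_insert.1 hY with rfl | hY
      · exact ⟨i₀, hi₀.1⟩
      · exact hGi Y hY
    · intro Y hY
      rcases mem_insert.1 hY with rfl | hY
      · exact card_image_le
      · exact hcard Y hY
    · rw [coe_insert]
      refine hdisj.insert fun Y hY _ => ?_
      exact hXR.mono_right (subset_biUnion_of_mem id hY)
    · rw [card_insert_of_notMem hX𝒢]; omega
    · have h1 : ∀ i, (1 / 2 : ℝ) ^ ((insert X 𝒢).filter (G i)).card ≤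
          w i - (if P i f then w i else 0) / 2 := by
        intro i
        rw [filter_insert]
        by_cases hi : G i X
        · rw [if_pos hi, card_insert_of_notMem (by simp [hX𝒢]), pow_succ]
          split_ifs <;> simp only [hw] <;> [skip; have := hw0 i] <;> [skip; simp only [hw] at this]
            <;> linarith
        · have : ¬ P i f := fun h => hi h.1
          simp [hi, this, hw]
      calc _ ≤ ∑ i, (w i - (if P i f then w i else 0) / 2) := sum_le_sum fun i _ => h1 i
        _ = Φ - (∑ i, if P i f then w i else 0) / 2 := by
          rw [sum_sub_distrib, sum_div]
        _ ≤ Φ * (1 - η / 4) := by linarith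
        _ ≤ (Fintype.card I * (1 - η / 4) ^ t) * (1 - η / 4) := by
          gcongr
          linarith
        _ = _ := by ring

/-- Greedy: split an `m`-set off `W`, give it to an unused absorber, repeat. Each round spends one
absorber, so `s` of them per `m`-set suffice. -/
theorem Pack.absorb {m : ℕ} (s : ℕ) (𝒢 : Finset (Finset V)) (W : Finset V)
    [∀ Q, DecidablePred (Absorbing F Q)]
    (hp : ∀ X ∈ 𝒢, Pack F X) (hd : (𝒢 : Set (Finset V)).PairwiseDisjoint id)
    (hW : W.card = m * s) (hWd : ∀ X ∈ 𝒢, Disjoint X W)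
    (hQ : ∀ Q ⊆ W, Q.card = m → s ≤ (𝒢.filter (Absorbing F Q)).card) :
    Pack F (𝒢.biUnion id ∪ W) := by
  induction s generalizing 𝒢 W with
  | zero =>
    have : W = ∅ := by simpa using hW
    rw [this, union_empty]
    exact Pack.biUnion _ _ hp hd
  | succ s ih =>
    obtain ⟨Q, hQW, hQm⟩ := exists_subset_card_eq (s := W) (n := m) (by rw [hW]; nlinarith)
    obtain ⟨X, hX⟩ : (𝒢.filter (Absorbing F Q)).Nonempty := by
      rw [← card_pos]
      have := hQ Q hQW hQm
      omega
    obtain ⟨hX𝒢, hXQ⟩ := mem_filter.1 hX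
    have key := ih (𝒢.erase X) (W \ Q) (fun Y hY => hp Y (mem_of_mem_erase hY))
      (hd.subset (by simp)) (by rw [card_sdiff_of_subset hQW, hW, hQm]; ring_nf; omega)
      (fun Y hY => (hWd Y (mem_of_mem_erase hY)).mono_right sdiff_subset)
      (fun Q' hQ' hm => by
        have := hQ Q' (hQ'.trans sdiff_subset) hm
        rw [filter_erase]
        have h2 := pred_card_le_card_erase (s := 𝒢.filter (Absorbing F Q')) (a := X)
        omega)
    convert hXQ.2.2.disjUnion key ?_ using 1
    · conv_lhs => rw [← insert_erase hX𝒢, biUnion_insert, id, ← union_sdiff_of_subset hQW]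
      ext v
      simp only [mem_union]
      tauto
    · rw [disjoint_union_left, disjoint_union_right, disjoint_union_right,
        disjoint_biUnion_right, disjoint_biUnion_right]
      refine ⟨⟨?_, (hWd X hX𝒢).mono_right sdiff_subset⟩, ?_, disjoint_sdiff⟩
      · intro Y hY
        exact hd hX𝒢 (mem_of_mem_erase hY) (ne_of_mem_erase hY).symm
      · intro Y hY
        exact ((hWd Y (mem_of_mem_erase hY)).mono_right hQW).symm

end Absorption

/-! ### From exchangeability to a perfect packing. -/

section PerfectPacking

open Finset

/-- Makes the final weight in `exists_disjoint_family`, summed over polynomially many indices, too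
small for any index to be served fewer than `s` times, with `s` linear in `n`. -/
theorem exists_pow_mul_pow_lt (m : ℕ) {β ρ : ℝ} (hβ : 0 < β) (hρ : 0 < ρ) (hρ1 : ρ < 1) :
    ∃ ω > 0, ∃ n₀ : ℕ, ∀ n ≥ n₀, ∀ s T : ℕ, (s : ℝ) ≤ ω * n → β * n - 1 ≤ T →
      (n : ℝ) ^ m * ρ ^ T < (1 / 2) ^ s := by
  -- `ρ ^ (β * n)` is `r ^ n * r ^ n`: one factor beats `n ^ m` and the rounding loss `1 / ρ`, the
  -- other is compared with `(1 / 2) ^ s`.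
  set r := ρ ^ (β / 2) with hr
  have hr0 : 0 < r := Real.rpow_pos_of_pos hρ _
  have hr1 : r < 1 := Real.rpow_lt_one hρ.le hρ1 (by positivity)
  have hlr : Real.log r < 0 := Real.log_neg hr0 hr1
  have hl2 : Real.log (1 / 2) < 0 := Real.log_neg (by norm_num) (by norm_num)
  have hlim := tendsto_pow_const_mul_const_pow_of_abs_lt_one m (r := r)
    (by rwa [abs_of_pos hr0])
  obtain ⟨n₀, hn₀⟩ := Filter.eventually_atTop.1 (hlim.eventually (gt_mem_nhds hρ))
  refine ⟨Real.log r / Real.log (1 / 2), div_pos_of_neg_of_neg hlr hl2, n₀, ?_⟩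
  intro n hn s T hs hT
  have h1 : r ^ n ≤ (1 / 2 : ℝ) ^ s := by
    rw [← Real.log_le_log_iff (by positivity) (by positivity), Real.log_pow, Real.log_pow]
    have := mul_le_mul_of_nonpos_right hs hl2.le
    have e : Real.log r / Real.log (1 / 2) * n * Real.log (1 / 2) = n * Real.log r := by
      field_simp
    linarith
  have h2 : ρ ^ T ≤ r ^ n * r ^ n / ρ := by
    rw [← Real.log_le_log_iff (by positivity) (by positivity), Real.log_pow,
      Real.log_div (by positivity) (by positivity), Real.log_mul (by positivity) (by positivity),
      Real.log_pow, hr, Real.log_rpow hρ]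
    have := mul_le_mul_of_nonpos_right hT (Real.log_neg hρ hρ1).le
    nlinarith
  have h3 := hn₀ n hn
  calc (n : ℝ) ^ m * ρ ^ T ≤ (n : ℝ) ^ m * (r ^ n * r ^ n / ρ) := by gcongr
    _ = (n ^ m * r ^ n) * (r ^ n / ρ) := by ring
    _ < ρ * (r ^ n / ρ) := by gcongr
    _ = r ^ n := by field_simp
    _ ≤ _ := h1

variable {V : Type*} [DecidableEq V] {F : Finset V → Prop}

/-- Greedy: by `hB`, the vertices of `R` and those already used never block all completions of the
next vertex. -/
theorem Pack.exists_cover [Fintype V] [Nonempty V] {κ : Type*} [Fintype κ] {c : ℝ}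
    (hF : ∀ X, F X → X.card = Fintype.card κ + 1)
    (h : ∀ x, c ≤ fr fun S : κ → V => F (insert x (univ.image S))) (R B : Finset V)
    (hB : (Fintype.card κ : ℝ) * (R.card + (Fintype.card κ + 1) * B.card) / Nat.card V < c) :
    ∃ X, Pack F X ∧ Disjoint X R ∧ B \ R ⊆ X ∧ X.card ≤ (Fintype.card κ + 1) * B.card := by
  classical
  induction B using Finset.induction_on with
  | empty => exact ⟨∅, Pack.empty, by simp, by simp, by simp⟩
  | insert b B hb ih =>
    obtain ⟨X, hX, hXR, hBX, hcard⟩ := ih (lt_of_le_of_lt (by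
      gcongr
      exact subset_insert _ _) hB)
    by_cases hbX : b ∈ X ∪ R
    · refine ⟨X, hX, hXR, ?_, hcard.trans ?_⟩
      · intro v hv
        rw [mem_sdiff, mem_insert] at hv
        rcases hv with ⟨rfl | hv, hvR⟩
        · exact (mem_union.1 hbX).resolve_right hvR
        · exact hBX (mem_sdiff.2 ⟨hv, hvR⟩)
      · gcongr
        exact subset_insert _ _
    · have h1 := fr_exists_mem (ι := κ) (X ∪ R)
      have h2 := fr_sub_le (fun S : κ → V => F (insert b (univ.image S)))
        fun S => ∃ i, S i ∈ X ∪ R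
      have h3 : (Nat.card κ : ℝ) * (X ∪ R).card / Nat.card V < c := by
        refine lt_of_le_of_lt ?_ hB
        rw [Nat.card_eq_fintype_card (α := κ)]
        gcongr
        have h4 := card_union_le X R
        have h5 : X.card + R.card ≤ R.card + (Fintype.card κ + 1) * (insert b B).card := by
          have : (Fintype.card κ + 1) * B.card ≤ (Fintype.card κ + 1) * (insert b B).card := by
            gcongr
            exact subset_insert _ _
          omega
        exact_mod_cast h4.trans h5
      have h6 := h b
      obtain ⟨S, hS, hSX⟩ := exists_of_fr_pos (lt_of_lt_of_le (by linarith) h2)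
      have hd : Disjoint (insert b (univ.image S)) (X ∪ R) := by
        rw [disjoint_left]
        intro v hv hvX
        simp only [mem_insert, mem_image, mem_univ, true_and] at hv
        rcases hv with rfl | ⟨i, rfl⟩
        · exact hbX hvX
        · exact hSX ⟨i, hvX⟩
      rw [disjoint_union_right] at hd
      refine ⟨_, Pack.union hS hX hd.1, disjoint_union_left.2 ⟨hd.2, hXR⟩, ?_, ?_⟩
      · intro v hv
        rw [mem_sdiff, mem_insert] at hv
        rcases hv with ⟨rfl | hv, hvR⟩
        · simp
        · exact mem_union_right _ (hBX (mem_sdiff.2 ⟨hv, hvR⟩))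
      · rw [card_union_of_disjoint hd.1, hF _ hS, card_insert_of_notMem hb]
        nlinarith

theorem Pack.exists_almost_perfect (hF0 : ∀ X, F X → X.Nonempty) (U : Finset V) :
    ∃ Y ⊆ U, Pack F Y ∧ ∀ X ⊆ U \ Y, ¬ F X := by
  classical
  obtain ⟨Y, hY, hmax⟩ := exists_max_image (U.powerset.filter (Pack F)) card
    ⟨∅, by simp [Pack.empty]⟩
  rw [mem_filter, mem_powerset] at hY
  refine ⟨Y, hY.1, hY.2, fun X hX hFX => ?_⟩
  have hd : Disjoint X Y := disjoint_sdiff_self_left.mono_left hX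
  have := hmax (X ∪ Y) (by
    rw [mem_filter, mem_powerset]
    exact ⟨union_subset (hX.trans sdiff_subset) hY.1, Pack.union hFX hY.2 hd⟩)
  rw [card_union_of_disjoint hd] at this
  have := card_pos.2 (hF0 X hFX)
  omega

/-- A family of `(k + 1)`-sets such that every vertex is in a positive proportion of its members
and such that a positive proportion of its members have one prescribed vertex in `A'` and the others
in `A`, for any two large sets `A` and `A'`, has a perfect packing. -/
theorem exists_perfect_pack (κ : Type) [Fintype κ] {c : ℝ} (hc : 0 < c) (c₂ : ℝ → ℝ)
    (hc₂ : ∀ δ, 0 < δ → 0 < c₂ δ) :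
    ∃ δ₀ > 0, ∃ n₀ : ℕ, ∀ (V : Type*) [Fintype V] [DecidableEq V] (F : Finset V → Prop),
      (∀ X, F X → X.card = Fintype.card κ + 1) → n₀ ≤ Nat.card V →
      (∀ x, c ≤ fr fun S : κ → V => F (insert x (univ.image S))) →
      (∀ δ ≥ δ₀, ∀ A A' : V → Prop, δ ≤ fr A → δ ≤ fr A' →
        c₂ δ ≤ fr fun w : (κ → V) × V =>
          (∀ i, A (w.1 i)) ∧ A' w.2 ∧ F (insert w.2 (univ.image w.1))) →
      Fintype.card κ + 1 ∣ Nat.card V → Pack F univ := by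
  classical
  set k := Fintype.card κ with hk
  set σ := min (1 / 2) (c / (4 * (k + 1) ^ 2)) with hσ
  have hσ0 : 0 < σ := by positivity
  obtain ⟨δ₁, hδ₁, η, hη, hexc⟩ := exists_exceptional_set κ hc c₂ hc₂ hσ0
  let J := κ ⊕ Unit
  have hJ : Fintype.card J = k + 1 := by simp [J, hk]
  let ι := SwapIndex κ ⊕ Unit
  let K := J ⊕ (J × ι)
  set M := Fintype.card K with hM
  have hM0 : 0 < M := Fintype.card_pos_iff.2 ⟨.inl (.inr ())⟩
  set θ := c₂ (1 / 2) with hθ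
  have hθ0 : 0 < θ := hc₂ _ (by norm_num)
  set ζ := min 1 (θ * η ^ (k + 1) / 2) with hζ
  have hζ0 : 0 < ζ := by positivity
  -- The first bound keeps the chosen absorbers from blocking more than `ζ / 2` of the choices; the
  -- second leaves room to cover the exceptional set.
  set β := min (ζ / (2 * M ^ 2)) (c / (4 * (k + 1) * M)) with hβ
  have hβ0 : 0 < β := by positivity
  have hζ1 : ζ ≤ 1 := min_le_left _ _
  obtain ⟨ω, hω, n₁, hn₁⟩ := exists_pow_mul_pow_lt (k + 1) hβ0 (ρ := 1 - ζ / 4) (by linarith)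
    (by linarith)
  obtain ⟨n₂, hn₂⟩ := exists_nat_ge (((M : ℝ) ^ 2 + M * (k + 1)) / (θ * η ^ (k + 1) / 2))
  -- The two-set hypothesis is used at three densities: `δ₁` for the exceptional set, `1 / 2` for
  -- members avoiding it, `ω` for the remainder.
  refine ⟨min (min δ₁ (1 / 2)) ω, by positivity, max 1 (max n₁ n₂), ?_⟩
  intro V _ _ F hF hn h1 h2 hdvd
  simp only [max_le_iff] at hn
  set n := Nat.card V with hndef
  have hn0 : (0 : ℝ) < n := by exact_mod_cast hn.1
  have : Nonempty V := (Nat.card_pos_iff.1 hn.1).1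
  obtain ⟨B, hBσ, hB⟩ := hexc V F h1 (h2 δ₁ ((min_le_left _ _).trans (min_le_left _ _)))
  -- many copies avoid the exceptional set
  have hcopies : θ ≤ fr fun y : J → V => (∀ j, ¬ B (y j)) ∧ F (univ.image y) := by
    have hb : 1 / 2 ≤ fr fun x => ¬ B x := by
      have := one_sub_le_fr_not B
      have : σ ≤ 1 / 2 := min_le_left _ _
      linarith
    have := h2 (1 / 2) ((min_le_left _ _).trans (min_le_right _ _)) _ _ hb hb
    let e : (J → V) ≃ (κ → V) × V :=
      { toFun := fun y => (fun i => y (.inl i), y (.inr ()))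
        invFun := fun w => Sum.elim w.1 fun _ => w.2
        left_inv := fun y => by ext (i | i) <;> rfl
        right_inv := fun w => rfl }
    rw [← fr_equiv e] at this
    refine this.trans (fr_mono ?_)
    rintro y ⟨a, b, hy⟩
    refine ⟨?_, ?_⟩
    · rintro (i | i)
      · exact a i
      · exact b
    · have hy' : F (insert (y (.inr ())) (univ.image fun i => y (.inl i))) := hy
      convert hy' using 1
      ext v
      simp only [mem_image, mem_univ, true_and, mem_insert, Sum.exists, J]
      constructor
      · rintro (⟨i, rfl⟩ | ⟨⟨⟩, rfl⟩) <;> simp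
      · rintro (rfl | ⟨i, rfl⟩) <;> simp
  let I := { Q : J → V // Function.Injective Q ∧ ∀ j, ¬ B (Q j) }
  have hI : (Fintype.card I : ℝ) ≤ (n : ℝ) ^ (k + 1) := by
    have := Fintype.card_subtype_le fun Q : J → V => Function.Injective Q ∧ ∀ j, ¬ B (Q j)
    rw [Fintype.card_fun, hJ, ← Nat.card_eq_fintype_card (α := V)] at this
    exact_mod_cast this
  have habs : ∀ i : I, ζ ≤ fr fun f : K → V =>
      Absorbing F (univ.image i.1) (univ.image f) := by
    intro i
    refine le_trans ?_ (le_fr_absorbing hη.le hB hcopies i.2.1 i.2.2)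
    rw [Nat.card_eq_fintype_card (α := J), hJ]
    have e : Nat.card (J ⊕ J × ι) = M := Nat.card_eq_fintype_card
    rw [e]
    have h3 : ((M : ℝ) ^ 2 + M * ((k + 1 : ℕ) : ℝ)) / n ≤ θ * η ^ (k + 1) / 2 := by
      push_cast
      rw [div_le_iff₀ hn0]
      rw [div_le_iff₀ (by positivity)] at hn₂
      have : (n₂ : ℝ) ≤ n := by exact_mod_cast hn.2.2
      calc _ ≤ _ := hn₂
        _ ≤ n * (θ * η ^ (k + 1) / 2) := by gcongr
        _ = _ := by ring
    have h4 : ζ ≤ θ * η ^ (k + 1) / 2 := min_le_right _ _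
    linarith
  set T := ⌊β * n⌋₊ with hT
  have hTle : (T : ℝ) ≤ β * n := Nat.floor_le (by positivity)
  have hTge : β * n - 1 ≤ T := by
    have := Nat.lt_floor_add_one (β * n)
    linarith
  have hM0' : (0 : ℝ) < M := by exact_mod_cast hM0
  have hK : Nonempty K := ⟨.inl (.inr ())⟩
  obtain ⟨𝒢, hG, hGcard, hGd, hGT, hGsum⟩ := exists_disjoint_family (κ := K)
    (fun (i : I) X => Absorbing F (univ.image i.1) X) hζ0 hζ1 habs (T := T) (by
      rw [← hM, ← hndef, div_le_iff₀ hn0]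
      have : β ≤ ζ / (2 * M ^ 2) := min_le_left _ _
      calc (M : ℝ) * (M * T) ≤ M * (M * (ζ / (2 * M ^ 2) * n)) := by
            gcongr
            exact hTle.trans (by gcongr)
        _ = _ := by field_simp) T le_rfl
  have hcount : ∀ (i : I) (s : ℕ), (s : ℝ) ≤ ω * n →
      s ≤ (𝒢.filter (Absorbing F (univ.image i.1))).card := by
    intro i s hs
    -- An index served fewer than `s` times would alone weigh at least `(1 / 2) ^ s`, more than the
    -- total.
    by_contra! hlt
    have a1 := hn₁ n hn.2.1 s T hs hTge
    have a2 := single_le_sum (f := fun i : I =>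
        (1 / 2 : ℝ) ^ (𝒢.filter fun X => Absorbing F (univ.image i.1) X).card)
      (fun i _ => by positivity) (mem_univ i)
    have a3 : (1 / 2 : ℝ) ^ s ≤ (1 / 2) ^ (𝒢.filter (Absorbing F (univ.image i.1))).card :=
      pow_le_pow_of_le_one (by norm_num) (by norm_num) hlt.le
    have a4 : (Fintype.card I : ℝ) * (1 - ζ / 4) ^ T ≤ (n : ℝ) ^ (k + 1) * (1 - ζ / 4) ^ T := by
      have : (0 : ℝ) ≤ 1 - ζ / 4 := by linarith
      gcongr
    linarith
  set R := 𝒢.biUnion id with hR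
  have hRcard : (R.card : ℝ) ≤ M * (β * n) := by
    have a1 : R.card ≤ 𝒢.card * M := card_biUnion_le_card_mul _ _ _ hGcard
    have a2 : 𝒢.card * M ≤ M * T := by rw [mul_comm]; gcongr
    calc (R.card : ℝ) ≤ ((M * T : ℕ) : ℝ) := by exact_mod_cast a1.trans a2
      _ ≤ _ := by push_cast; gcongr
  have hGp : ∀ X ∈ 𝒢, Pack F X := fun X hX => (hG X hX).elim fun i h => h.1
  -- cover the exceptional set
  obtain ⟨X, hX, hXR, hBX, -⟩ := Pack.exists_cover hF h1 R (univ.filter B) (by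
    rw [← hk, ← hndef, div_lt_iff₀ hn0]
    have b1 : ((univ.filter B).card : ℝ) ≤ σ * n := by
      rw [fr_eq_card, div_le_iff₀ (by rwa [← Nat.card_eq_fintype_card]),
        ← Nat.card_eq_fintype_card] at hBσ
      exact hBσ
    have b2 : σ ≤ c / (4 * (k + 1) ^ 2) := min_le_right _ _
    have b3 : β ≤ c / (4 * (k + 1) * M) := min_le_right _ _
    calc (k : ℝ) * (R.card + (k + 1) * (univ.filter B).card)
        ≤ (k + 1) * (M * (c / (4 * (k + 1) * M) * n) +
          (k + 1) * (c / (4 * (k + 1) ^ 2) * n)) := by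
          gcongr
          · linarith
          · exact hRcard.trans (by gcongr)
          · exact b1.trans (by gcongr)
      _ = c * n / 2 := by field_simp; ring
      _ < c * n := half_lt_self (by positivity))
  -- pack almost everything else
  obtain ⟨Y, hYU, hY, hYmax⟩ := Pack.exists_almost_perfect
    (fun X hX => card_pos.1 (by rw [hF X hX]; omega)) (univ \ (R ∪ X))
  set W := (univ \ (R ∪ X)) \ Y with hW
  have hRp : Pack F R := Pack.biUnion _ _ hGp hGd
  have hYRX : Disjoint (R ∪ X) Y := disjoint_sdiff.mono_right hYU
  have hZ : Pack F (R ∪ X ∪ Y) := (hRp.disjUnion hX hXR.symm).disjUnion hY hYRX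
  have hWZ : W = univ \ (R ∪ X ∪ Y) := by rw [hW, sdiff_sdiff_left]; rfl
  have hWd : Disjoint W (R ∪ X ∪ Y) := hWZ ▸ disjoint_sdiff_self_left
  have hWcard : k + 1 ∣ W.card := by
    have c1 : W.card + (R ∪ X ∪ Y).card = n := by
      rw [← card_union_of_disjoint hWd, hWZ, sdiff_union_of_subset (subset_univ _), card_univ,
        hndef, Nat.card_eq_fintype_card]
    have c2 := hZ.dvd_card hF
    rw [← c1] at hdvd
    exact (Nat.dvd_add_left c2).1 hdvd
  obtain ⟨s, hs⟩ := hWcard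
  have hsω : (s : ℝ) ≤ ω * n := by
    by_contra! hlt
    have d1 : (s : ℝ) ≤ W.card := by
      rw [hs]
      exact_mod_cast Nat.le_mul_of_pos_left s (by omega)
    have d2 : ω ≤ fr fun v => v ∈ W := by
      rw [fr_mem, ← hndef, le_div_iff₀ hn0]
      linarith
    -- A larger remainder would contain another member of `F`, against the maximality of `Y`.
    obtain ⟨w, hw1, hw2, hw3⟩ := exists_of_fr_pos ((hc₂ ω hω).trans_le
      (h2 ω (min_le_right _ _) _ _ d2 d2))
    refine hYmax _ ?_ hw3
    intro v hv
    simp only [mem_insert, mem_image, mem_univ, true_and] at hv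
    rcases hv with rfl | ⟨i, rfl⟩
    · exact hw2
    · exact hw1 i
  have hWB : ∀ v ∈ W, ¬ B v := by
    intro v hv hBv
    have hvZ := disjoint_left.1 hWd hv
    simp only [mem_union, not_or] at hvZ
    exact hvZ.1.2 (hBX (by simp [hBv, hvZ.1.1]))
  have hWdR : Disjoint W R := hWd.mono_right
    (subset_union_left.trans subset_union_left)
  have hfinal := Pack.absorb (F := F) s 𝒢 W hGp hGd hs
    (fun Z hZ => (hWdR.mono_right (subset_biUnion_of_mem id hZ)).symm) (by
      intro Q hQW hQ
      let e : J ≃ Q := Fintype.equivOfCardEq (by rw [hJ, Fintype.card_coe, hQ])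
      have hinj : Function.Injective fun j => (e j : V) :=
        Subtype.val_injective.comp e.injective
      have himg : univ.image (fun j => (e j : V)) = Q := by
        apply eq_of_subset_of_card_le
        · intro v hv
          simp only [mem_image, mem_univ, true_and] at hv
          obtain ⟨j, rfl⟩ := hv
          exact (e j).2
        · rw [card_image_of_injective _ hinj, card_univ, hJ, hQ]
      have := hcount ⟨fun j => (e j : V), hinj, fun j => hWB _ (hQW (e j).2)⟩ s hsω
      simp only [himg] at this
      exact this)
  have hd1 : Disjoint (R ∪ W) (X ∪ Y) := by
    have e1 := disjoint_union_right.1 hWd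
    have e2 := disjoint_union_right.1 e1.1
    have e3 := disjoint_union_left.1 hYRX
    rw [disjoint_union_left, disjoint_union_right, disjoint_union_right]
    exact ⟨⟨hXR.symm, e3.1⟩, e2.2, e1.2⟩
  convert hfinal.disjUnion (hX.disjUnion hY (disjoint_union_left.1 hYRX).2) hd1 using 1
  symm
  rw [eq_univ_iff_forall]
  intro v
  by_cases hv : v ∈ R ∪ X ∪ Y
  · simp only [mem_union] at hv ⊢
    tauto
  · have : v ∈ W := by rw [hWZ]; simpa using hv
    simp [this]

end PerfectPacking

/-! ### From homomorphisms to copies, and consequences of denseness. -/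

section Concrete

open Finset

/-- The vertex sets of the injective maps satisfying `Good`. -/
def Family {U : Type*} [DecidableEq U] {m : ℕ} (Good : (Fin m → U) → Prop) (X : Finset U) : Prop :=
  ∃ f : Fin m → U, Function.Injective f ∧ univ.image f = X ∧ Good f

theorem Family.card {U : Type*} [DecidableEq U] {m : ℕ} {Good : (Fin m → U) → Prop} {X : Finset U}
    (h : Family Good X) : X.card = m := by
  obtain ⟨f, hf, rfl, -⟩ := h
  rw [card_image_of_injective _ hf, card_univ, Fintype.card_fin]

theorem Pack.exists_partition {U : Type*} [DecidableEq U] {F : Finset U → Prop} {X : Finset U}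
    (h : Pack F X) : ∃ 𝒢 : Finset (Finset U), (∀ Y ∈ 𝒢, F Y) ∧
      (𝒢 : Set (Finset U)).PairwiseDisjoint id ∧ 𝒢.biUnion id = X := by
  induction h with
  | empty => exact ⟨∅, by simp⟩
  | @union X Y hX _ hd ih =>
    obtain ⟨𝒢, h1, h2, h3⟩ := ih
    refine ⟨insert X 𝒢, ?_, ?_, ?_⟩
    · intro Z hZ
      rcases mem_insert.1 hZ with rfl | hZ
      · exact hX
      · exact h1 Z hZ
    · rw [coe_insert]
      refine h2.insert fun Z hZ _ => ?_
      exact hd.mono_right (h3 ▸ subset_biUnion_of_mem id hZ)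
    · rw [biUnion_insert, h3, id]

theorem hasPerfectPacking_of_pack {V : Type*} {H : Hypergraph V} [DecidableEq V(H)] [Fintype V(H)]
    {m : ℕ} {F : Hypergraph (Fin m)} (hF : V(F) = Set.univ)
    (h : Pack (Family fun f : Fin m → V(H) =>
      ∀ e ∈ E(F), (fun i => (f i : V)) '' e ∈ E(H)) univ) :
    Hypergraph.HasPerfectPacking F H := by
  obtain ⟨𝒢, h1, h2, h3⟩ := h.exists_partition
  choose f hinj himg hcopy using h1
  let e := 𝒢.equivFin
  have hrange : ∀ X, ∀ hX : X ∈ 𝒢, (fun i => (f X hX i : V)) '' V(F) = Subtype.val '' (X : Set V(H)) := by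
    intro X hX
    rw [hF, Set.image_univ]
    conv_rhs => rw [← himg X hX]
    rw [coe_image, coe_univ, Set.image_univ, ← Set.range_comp]
    rfl
  refine ⟨𝒢.card, fun i j => f _ (e.symm i).2 j, ?_, ?_, ?_⟩
  · intro i
    have hi := (e.symm i).2
    refine ⟨?_, fun j _ => (f _ _ j).2, hcopy _ hi⟩
    exact (Subtype.val_injective.comp (hinj _ hi)).injOn
  · intro i j hij
    rw [hrange _ (e.symm i).2, hrange _ (e.symm j).2, Set.disjoint_image_iff Subtype.val_injective,
      disjoint_coe]
    exact h2 (e.symm i).2 (e.symm j).2 fun h => hij (e.symm.injective (Subtype.ext h))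
  · ext v
    simp only [Set.mem_iUnion]
    constructor
    · rintro ⟨i, hi⟩
      rw [hrange _ (e.symm i).2] at hi
      obtain ⟨u, -, rfl⟩ := hi
      exact u.2
    · intro hv
      have : (⟨v, hv⟩ : V(H)) ∈ 𝒢.biUnion id := by rw [h3]; exact mem_univ _
      obtain ⟨X, hX, hvX⟩ := mem_biUnion.1 this
      refine ⟨e ⟨X, hX⟩, ?_⟩
      rw [hrange _ (e.symm _).2]
      exact ⟨⟨v, hv⟩, by simpa using hvX, rfl⟩

theorem fr_not_injective_or_eq_le {U : Type*} [Fintype U] [Nonempty U] {k : ℕ} (x : U) :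
    fr (fun f : Fin k → U => ¬ Function.Injective f ∨ ∃ i, f i ∈ ({x} : Finset U)) ≤
      ((k : ℝ) ^ 2 + k) / Nat.card U := by
  have h₁ := fr_not_injective (ι := Fin k) (V := U)
  have h₂ := fr_exists_mem (ι := Fin k) (V := U) {x}
  rw [card_singleton] at h₂
  rw [Nat.card_eq_fintype_card (α := Fin k), Fintype.card_fin] at h₁ h₂
  rw [Nat.cast_one, mul_one] at h₂
  rw [add_div]
  exact (fr_or_le _ _).trans (add_le_add h₁ h₂)

theorem Family.of_cons {U : Type*} [DecidableEq U] {k : ℕ} {Good : (Fin (k + 1) → U) → Prop} {x : U} {S : Fin k → U}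
    (hS : Good (Fin.cons x S))
    (h : ¬ (¬ Function.Injective S ∨ ∃ i, S i ∈ ({x} : Finset U))) :
    Family Good (insert x (univ.image S)) := by
  simp only [not_or, not_not, not_exists, mem_singleton] at h
  refine ⟨Fin.cons x S, Fin.cons_injective_iff.2 ⟨?_, h.1⟩, ?_, hS⟩
  · rintro ⟨i, hi⟩
    exact h.2 i hi
  · ext v
    simp [Fin.exists_fin_succ, eq_comm]

section Counting

variable {U : Type*} [Fintype U] [DecidableEq U] [Nonempty U]

theorem le_fr_family {k : ℕ} (Good : (Fin (k + 1) → U) → Prop) (x : U) :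
    fr (fun S : Fin k → U => Good (Fin.cons x S)) - ((k : ℝ) ^ 2 + k) / Nat.card U ≤
      fr fun S : Fin k → U => Family Good (insert x (univ.image S)) :=
  (sub_le_sub le_rfl (fr_not_injective_or_eq_le x)).trans <|
    (fr_sub_le _ _).trans <| fr_mono fun _ hS => Family.of_cons hS.1 hS.2

theorem le_fr_family_prod {k : ℕ} (Good : (Fin (k + 1) → U) → Prop) (P : (Fin k → U) × U → Prop) :
    fr (fun w => P w ∧ Good (Fin.cons w.2 w.1)) - ((k : ℝ) ^ 2 + k) / Nat.card U ≤
      fr fun w => P w ∧ Family Good (insert w.2 (univ.image w.1)) := by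
  have h := fr_prod_le' (Q := fun (x : U) (f : Fin k → U) =>
      ¬ Function.Injective f ∨ ∃ i, f i ∈ ({x} : Finset U)) fr_not_injective_or_eq_le
  rw [← fr_swap] at h
  exact (sub_le_sub le_rfl h).trans <| (fr_sub_le _ _).trans <| fr_mono fun _ hS =>
    ⟨hS.1.1, Family.of_cons hS.1.2 hS.2⟩

end Counting

section Dense

variable {U : Type*} [Fintype U] {E : U → U → U → Prop} {p μ : ℝ}

/-- Apply denseness to `X`, `X` and the set `C` of low-degree vertices: the low degrees account for
at most half of the main term, so `μ` must pay for the other half. -/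
theorem fr_low_degree_mul_le
    (hE : ∀ X Y Z : U → Prop, p * (fr X * fr Y * fr Z) - μ ≤ fr fun w : (U × U) × U =>
      (X w.1.1 ∧ Y w.1.2 ∧ Z w.2) ∧ E w.1.1 w.1.2 w.2) (X : U → Prop) {d : ℝ}
    (hd : d ≤ p * (fr X * fr X) / 2) :
    fr (fun c => fr (fun w : U × U => X w.1 ∧ X w.2 ∧ E w.1 w.2 c) < d) *
      (p * (fr X * fr X) / 2) ≤ μ := by
  set C := fun c => fr (fun w : U × U => X w.1 ∧ X w.2 ∧ E w.1 w.2 c) < d with hC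
  have h1 := hE X X C
  have h2 := fr_prod_le (P := C) (Q := fun c (w : U × U) => X w.1 ∧ X w.2 ∧ E w.1 w.2 c) (b := d)
    fun c hc => hc.le
  rw [← fr_swap] at h2
  have h3 : fr (fun w : (U × U) × U => (X w.1.1 ∧ X w.1.2 ∧ C w.2) ∧ E w.1.1 w.1.2 w.2) ≤
      fr C * d := le_trans (fr_mono fun w hw => ⟨hw.1.2.2, hw.1.1, hw.1.2.1, hw.2⟩) h2
  have h4 := mul_le_mul_of_nonneg_left hd (fr_nonneg C)
  nlinarith

theorem fr_join {α : Type*} [Fintype α] [Nonempty α] {L : U → α → Prop} {β : Type*} [Fintype β]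
    {D : U → β → Prop} {l d b : ℝ} (hd : 0 ≤ d) (hL : l ≤ fr fun w : U × α => L w.1 w.2)
    (hD : fr (fun c => fr (D c) < d) ≤ b) :
    (l - b) * d ≤ fr fun w : (U × α) × β => L w.1.1 w.1.2 ∧ D w.1.1 w.2 := by
  have h1 := fr_sub_le (fun w : U × α => L w.1 w.2) fun w => fr (D w.1) < d
  rw [unif_fst fun c => fr (D c) < d] at h1
  have h2 := le_fr_prod (P := fun w : U × α => L w.1 w.2 ∧ ¬ fr (D w.1) < d)
    (Q := fun w => D w.1) (b := d) fun w hw => not_lt.1 hw.2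
  refine le_trans ?_ (h2.trans (fr_mono fun w hw => ⟨hw.1.1, hw.2⟩))
  gcongr
  linarith

end Dense

end Concrete

/-! ### Denseness and minimum degree as probabilities. -/

section Transfer

variable {V : Type*} {H : Hypergraph V} {n : ℕ} {p μ α : ℝ}

theorem Hypergraph.IsQuasirandomKGraph.le_fr_edges (h : H.IsQuasirandomKGraph 3 n p μ α)
    (hn : 0 < n) (X Y Z : V(H) → Prop) :
    p * (fr X * fr Y * fr Z) - μ ≤ fr fun w : (V(H) × V(H)) × V(H) =>
      (X w.1.1 ∧ Y w.1.2 ∧ Z w.2) ∧ ({(w.1.1 : V), (w.1.2 : V), (w.2 : V)} : Set V) ∈ E(H) := by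
  have : Finite V(H) := h.isKGraph.1
  have hcard : Nat.card V(H) = n := by rw [Nat.card_coe_set_eq, h.card_vertexSet]
  have hn' : (0 : ℝ) < n := by exact_mod_cast hn
  set P := fun w : (V(H) × V(H)) × V(H) =>
      (X w.1.1 ∧ Y w.1.2 ∧ Z w.2) ∧ ({(w.1.1 : V), (w.1.2 : V), (w.2 : V)} : Set V) ∈ E(H) with hP
  have himg : ∀ Q : V(H) → Prop, ((Subtype.val '' {u | Q u} : Set V).ncard : ℝ) = fr Q * n := by
    intro Q
    rw [Set.ncard_image_of_injective _ Subtype.val_injective, fr, hcard, ← Nat.card_coe_set_eq]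
    field_simp
    rfl
  have hd := h.isDense ![Subtype.val '' {u | X u}, Subtype.val '' {u | Y u},
    Subtype.val '' {u | Z u}] (by
      intro i
      fin_cases i <;> exact (Set.image_subset_range _ _).trans Subtype.range_coe.subset)
  rw [Fin.prod_univ_three] at hd
  simp only [Matrix.cons_val_zero, Matrix.cons_val_one, Matrix.cons_val] at hd
  rw [himg, himg, himg, h.card_vertexSet] at hd
  have hcount : (H.edgeTuples ![Subtype.val '' {u | X u}, Subtype.val '' {u | Y u},
      Subtype.val '' {u | Z u}] : ℝ) ≤ fr P * n ^ 3 := by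
    have e1 : fr P * (n : ℝ) ^ 3 = ({w | P w}.ncard : ℝ) := by
      rw [fr, Nat.card_prod, Nat.card_prod, hcard, ← Nat.card_coe_set_eq]
      push_cast
      field_simp
      rfl
    rw [e1]
    norm_cast
    refine le_trans (Set.ncard_le_ncard (t := (fun w : (V(H) × V(H)) × V(H) =>
      ![(w.1.1 : V), (w.1.2 : V), (w.2 : V)]) '' {w | P w}) ?_ (Set.toFinite _))
      (Set.ncard_image_le (Set.toFinite _))
    rintro x ⟨hx, hxE⟩
    obtain ⟨a, ha, ha'⟩ := hx 0
    obtain ⟨b, hb, hb'⟩ := hx 1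
    obtain ⟨c, hc, hc'⟩ := hx 2
    refine ⟨((a, b), c), ⟨⟨ha, hb, hc⟩, ?_⟩, ?_⟩
    · convert hxE using 1
      simp only [ha', hb', hc']
      ext v
      simp [Fin.exists_fin_succ, eq_comm]
    · ext i
      fin_cases i <;> simp [ha', hb', hc']
  have h3 := hd.trans hcount
  have h4 : (p * (fr X * fr Y * fr Z) - μ) * (n : ℝ) ^ 3 ≤ fr P * n ^ 3 := by
    refine le_trans (le_of_eq ?_) h3
    ring
  exact le_of_mul_le_mul_right h4 (by positivity)

theorem Hypergraph.IsQuasirandomKGraph.le_fr_link (h : H.IsQuasirandomKGraph 3 n p μ α)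
    (hα : 0 ≤ α) (hn : 2 ≤ n) (x : V(H)) :
    α / 4 ≤ fr fun w : V(H) × V(H) => ({(x : V), (w.1 : V), (w.2 : V)} : Set V) ∈ E(H) := by
  have : Finite V(H) := h.isKGraph.1
  have hcard : Nat.card V(H) = n := by rw [Nat.card_coe_set_eq, h.card_vertexSet]
  have hn' : (2 : ℝ) ≤ n := by exact_mod_cast hn
  set P := fun w : V(H) × V(H) => ({(x : V), (w.1 : V), (w.2 : V)} : Set V) ∈ E(H) with hP
  have hd := h.minDegree x x.2
  have hcount : (H.vertexDegree x : ℝ) ≤ fr P * n ^ 2 := by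
    have e1 : fr P * (n : ℝ) ^ 2 = ({w | P w}.ncard : ℝ) := by
      rw [fr, Nat.card_prod, hcard, ← Nat.card_coe_set_eq]
      push_cast
      field_simp
      rfl
    rw [e1]
    norm_cast
    refine le_trans (Set.ncard_le_ncard (t := (fun w : V(H) × V(H) =>
      ({(x : V), (w.1 : V), (w.2 : V)} : Set V)) '' {w | P w}) ?_ (Set.toFinite _))
      (Set.ncard_image_le (Set.toFinite _))
    rintro e ⟨he, hxe⟩
    have key : ∃ b c, e = {(x : V), b, c} := by
      obtain ⟨a, b, c, -, -, -, rfl⟩ := Set.ncard_eq_three.1 (h.isKGraph.2 e he)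
      rcases hxe with hx | hx | hx
      · exact ⟨b, c, by rw [hx]⟩
      · exact ⟨a, c, by rw [hx, Set.insert_comm]⟩
      · rw [Set.mem_singleton_iff] at hx
        exact ⟨a, b, by rw [hx, Set.pair_comm b c, Set.insert_comm]⟩
    obtain ⟨b, c, rfl⟩ := key
    have hsub := H.subset_vertexSet_of_mem_edgeSet he
    exact ⟨(⟨b, hsub (by simp)⟩, ⟨c, hsub (by simp)⟩), he, rfl⟩
  rw [show 3 - 1 = 2 from rfl, Nat.cast_choose_two] at hd
  have h4 : α / 4 * (n : ℝ) ^ 2 ≤ fr P * n ^ 2 := by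
    refine le_trans ?_ (hd.trans hcount)
    -- This is where `n ≥ 2` is needed and where the 4 in `α / 4` comes from.
    have : (n : ℝ) ^ 2 / 4 ≤ n * (n - 1) / 2 := by nlinarith
    calc α / 4 * (n : ℝ) ^ 2 = α * (n ^ 2 / 4) := by ring
      _ ≤ _ := by gcongr
  exact le_of_mul_le_mul_right h4 (by positivity)

end Transfer

/-! ### Counting cherries and copies of C₄(2+1). -/

section Counting

variable {U : Type*} [Fintype U] {E : U → U → U → Prop} {p μ a δ : ℝ}

/-- `f` maps the edges of the cherry to edges. -/
def CherryHom (E : U → U → U → Prop) (f : Fin 4 → U) : Prop :=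
  E (f 0) (f 1) (f 2) ∧ E (f 0) (f 1) (f 3)

/-- `f` maps the edges of `C₄(2+1)` to edges. -/
def CycleHom (E : U → U → U → Prop) (f : Fin 6 → U) : Prop :=
  (E (f 0) (f 1) (f 4) ∧ E (f 0) (f 1) (f 5)) ∧ E (f 2) (f 3) (f 4) ∧ E (f 2) (f 3) (f 5)

theorem sq_le_fr_cherryHom (ha : 0 ≤ a) {x : U}
    (hL : a ≤ fr fun w : U × U => E x w.1 w.2) :
    a ^ 2 ≤ fr fun S : Fin 3 → U => CherryHom E (Fin.cons x S) := by
  let e : (Fin 3 → U) ≃ U × (U × U) :=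
    { toFun := fun S => (S 0, S 1, S 2)
      invFun := fun w => ![w.1, w.2.1, w.2.2]
      left_inv := fun S => by ext i; fin_cases i <;> rfl
      right_inv := fun w => rfl }
  have h := fr_sq_le fun b c => E x b c
  rw [← fr_equiv e] at h
  exact (pow_le_pow_left₀ ha hL 2).trans h

theorem sq_le_fr_cherryHom_prod {A A' : U → Prop} (hp : 0 ≤ p) (hδ : 0 ≤ δ)
    (hE : ∀ X Y Z : U → Prop, p * (fr X * fr Y * fr Z) - μ ≤ fr fun w : (U × U) × U =>
      (X w.1.1 ∧ Y w.1.2 ∧ Z w.2) ∧ E w.1.1 w.1.2 w.2)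
    (hμ : μ ≤ p * δ ^ 3 / 2) (hA : δ ≤ fr A) (hA' : δ ≤ fr A') :
    (p * δ ^ 3 / 2) ^ 2 ≤ fr fun w : (Fin 3 → U) × U =>
      ((∀ i, A (w.1 i)) ∧ A' w.2) ∧ CherryHom E (Fin.cons w.2 w.1) := by
  let e : (Fin 3 → U) × U ≃ (U × U) × (U × U) :=
    { toFun := fun w => ((w.2, w.1 0), w.1 1, w.1 2)
      invFun := fun w => (![w.1.2, w.2.1, w.2.2], w.1.1)
      left_inv := fun S => by
        ext i
        · fin_cases i <;> rfl
        · rfl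
      right_inv := fun w => rfl }
  have h0 : p * δ ^ 3 / 2 ≤ p * (fr A' * fr A * fr A) - μ := by
    have : p * δ ^ 3 ≤ p * (fr A' * fr A * fr A) := by
      rw [show δ ^ 3 = δ * δ * δ by ring]
      have := fr_nonneg A
      have := fr_nonneg A'
      gcongr
    linarith
  have h := fr_sq_le fun (b : U × U) c => (A' b.1 ∧ A b.2 ∧ A c) ∧ E b.1 b.2 c
  rw [← fr_equiv e] at h
  refine (pow_le_pow_left₀ (by positivity) (h0.trans (hE A' A A)) 2).trans
    (h.trans (fr_mono ?_))
  rintro w ⟨⟨⟨h1, h2, h3⟩, h4⟩, ⟨-, -, h5⟩, h6⟩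
  refine ⟨⟨?_, h1⟩, h4, h6⟩
  intro i
  fin_cases i <;> assumption

/-- Take an edge `x b c` and a second edge through `c`, then double `c`. The degree of `x` supplies
the first edge; denseness supplies the second, since few `c` have a sparse link. -/
theorem sq_le_fr_cycleHom [Nonempty U] (hp : 0 < p) (ha : 0 ≤ a) (hμ : μ ≤ p * a / 4)
    (hE : ∀ X Y Z : U → Prop, p * (fr X * fr Y * fr Z) - μ ≤ fr fun w : (U × U) × U =>
      (X w.1.1 ∧ Y w.1.2 ∧ Z w.2) ∧ E w.1.1 w.1.2 w.2) {x : U}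
    (hL : a ≤ fr fun w : U × U => E x w.1 w.2) :
    (p * a / 4) ^ 2 ≤ fr fun S : Fin 5 → U => CycleHom E (Fin.cons x S) := by
  have hlow := fr_low_degree_mul_le hE (fun _ => True) (d := p / 2) (by rw [fr_true]; linarith)
  rw [fr_true, ← le_div_iff₀ (by positivity)] at hlow
  rw [← fr_swap] at hL
  have hjoin := fr_join (L := fun c w => E x w c)
    (D := fun c (w : U × U) => True ∧ True ∧ E w.1 w.2 c) (by positivity) hL hlow
  let e₁ : (U × (U × U)) × U ≃ (U × U) × (U × U) :=
    { toFun := fun w => ((w.2, w.1.1), w.1.2)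
      invFun := fun w => ((w.1.2, w.2), w.1.1)
      left_inv := fun w => rfl
      right_inv := fun w => rfl }
  let e : (Fin 5 → U) ≃ (U × (U × U)) × (U × U) :=
    { toFun := fun S => ((S 0, S 1, S 2), S 3, S 4)
      invFun := fun w => ![w.1.1, w.1.2.1, w.1.2.2, w.2.1, w.2.2]
      left_inv := fun S => by ext i; fin_cases i <;> rfl
      right_inv := fun w => rfl }
  rw [← fr_equiv e₁] at hjoin
  have h := fr_sq_le fun (b : U × (U × U)) c => E x b.1 c ∧ True ∧ True ∧ E b.2.1 b.2.2 c
  rw [← fr_equiv e] at h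
  have h0 : p * a / 4 ≤ (a - μ / (p * (1 * 1) / 2)) * (p / 2) := by
    have : (a - μ / (p * (1 * 1) / 2)) * (p / 2) = p * a / 2 - μ := by field_simp
    linarith
  refine (pow_le_pow_left₀ (by positivity) (h0.trans hjoin) 2).trans (h.trans (fr_mono ?_))
  rintro S ⟨⟨h1, -, -, h2⟩, h3, -, -, h4⟩
  exact ⟨⟨h1, h3⟩, h2, h4⟩

/-- The same doubling inside `A`, with `x` ranging over `A'`; now denseness supplies both edges. -/
theorem sq_le_fr_cycleHom_prod [Nonempty U] {A A' : U → Prop} (hp : 0 < p) (hδ : 0 < δ)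
    (hE : ∀ X Y Z : U → Prop, p * (fr X * fr Y * fr Z) - μ ≤ fr fun w : (U × U) × U =>
      (X w.1.1 ∧ Y w.1.2 ∧ Z w.2) ∧ E w.1.1 w.1.2 w.2)
    (hμ : μ ≤ p * δ ^ 3 / 2) (hμ' : μ ≤ p ^ 2 * δ ^ 5 / 8) (hA : δ ≤ fr A) (hA' : δ ≤ fr A') :
    (p ^ 2 * δ ^ 5 / 8) ^ 2 ≤ fr fun w : (Fin 5 → U) × U =>
      ((∀ i, A (w.1 i)) ∧ A' w.2) ∧ CycleHom E (Fin.cons w.2 w.1) := by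
  have hAA : p * δ ^ 2 / 2 ≤ p * (fr A * fr A) / 2 := by
    rw [sq]
    have := fr_nonneg A
    gcongr
  have hlow : fr (fun c => fr (fun w : U × U => A w.1 ∧ A w.2 ∧ E w.1 w.2 c) < p * δ ^ 2 / 2) ≤
      μ / (p * δ ^ 2 / 2) := by
    rw [le_div_iff₀ (by positivity)]
    exact (mul_le_mul_of_nonneg_left hAA (fr_nonneg _)).trans (fr_low_degree_mul_le hE A hAA)
  have h0 : p * δ ^ 3 / 2 ≤ p * (fr A' * fr A * fr A) - μ := by
    have : p * δ ^ 3 ≤ p * (fr A' * fr A * fr A) := by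
      rw [show δ ^ 3 = δ * δ * δ by ring]
      have := fr_nonneg A
      have := fr_nonneg A'
      gcongr
    linarith
  have hL := h0.trans (hE A' A A)
  rw [← fr_swap] at hL
  have hjoin := fr_join (L := fun c (w : U × U) => (A' w.1 ∧ A w.2 ∧ A c) ∧ E w.1 w.2 c)
    (D := fun c (w : U × U) => A w.1 ∧ A w.2 ∧ E w.1 w.2 c) (by positivity) hL hlow
  let e₁ : ((U × U) × (U × U)) × U ≃ (U × (U × U)) × (U × U) :=
    { toFun := fun w => ((w.2, w.1.1), w.1.2)
      invFun := fun w => ((w.1.2, w.2), w.1.1)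
      left_inv := fun w => rfl
      right_inv := fun w => rfl }
  let e : (Fin 5 → U) × U ≃ ((U × U) × (U × U)) × (U × U) :=
    { toFun := fun w => (((w.2, w.1 0), w.1 1, w.1 2), w.1 3, w.1 4)
      invFun := fun w => (![w.1.1.2, w.1.2.1, w.1.2.2, w.2.1, w.2.2], w.1.1.1)
      left_inv := fun S => by
        ext i
        · fin_cases i <;> rfl
        · rfl
      right_inv := fun w => rfl }
  rw [← fr_equiv e₁] at hjoin
  have h := fr_sq_le fun (b : (U × U) × (U × U)) c => ((A' b.1.1 ∧ A b.1.2 ∧ A c) ∧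
    E b.1.1 b.1.2 c) ∧ A b.2.1 ∧ A b.2.2 ∧ E b.2.1 b.2.2 c
  rw [← fr_equiv e] at h
  have h1 : p ^ 2 * δ ^ 5 / 8 ≤ (p * δ ^ 3 / 2 - μ / (p * δ ^ 2 / 2)) * (p * δ ^ 2 / 2) := by
    have : (p * δ ^ 3 / 2 - μ / (p * δ ^ 2 / 2)) * (p * δ ^ 2 / 2) = p ^ 2 * δ ^ 5 / 4 - μ := by
      field_simp
      ring
    linarith
  refine (pow_le_pow_left₀ (by positivity) (h1.trans hjoin) 2).trans (h.trans (fr_mono ?_))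
  rintro w ⟨⟨⟨⟨a1, a2, a3⟩, a4⟩, a5, a6, a7⟩, ⟨⟨-, -, b3⟩, b4⟩, -, -, b7⟩
  refine ⟨⟨?_, a1⟩, ⟨a4, b4⟩, a7, b7⟩
  intro i
  fin_cases i <;> assumption

end Counting

/-- Half of each homomorphism count is given up for non-injective maps. Monotonicity of `c₂` lets
one `n₀` serve every `δ ≥ δ₀`. -/
theorem exists_pack_of_homCounts.{u} {k : ℕ} (Hom : ∀ {U : Type u}, (U → U → U → Prop) →
      (Fin (k + 1) → U) → Prop) {c : ℝ} (hc : 0 < c) (c₂ : ℝ → ℝ) (hc₂ : ∀ δ, 0 < δ → 0 < c₂ δ)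
    (hmono : ∀ δ δ', 0 < δ → δ ≤ δ' → c₂ δ ≤ c₂ δ') :
    ∃ δ₀ > 0, ∃ n₀ : ℕ, ∀ (U : Type u) [Fintype U] [DecidableEq U] (E : U → U → U → Prop),
      n₀ ≤ Nat.card U → (∀ x, c ≤ fr fun S : Fin k → U => Hom E (Fin.cons x S)) →
      (∀ δ ≥ δ₀, ∀ A A' : U → Prop, δ ≤ fr A → δ ≤ fr A' →
        c₂ δ ≤ fr fun w : (Fin k → U) × U =>
          ((∀ i, A (w.1 i)) ∧ A' w.2) ∧ Hom E (Fin.cons w.2 w.1)) →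
      k + 1 ∣ Nat.card U → Pack (Family (Hom E)) Finset.univ := by
  obtain ⟨δ₀, hδ₀, n₁, hn₁⟩ := exists_perfect_pack (Fin k) (c := c / 2) (by positivity)
    (fun δ => c₂ δ / 2) fun δ hδ => half_pos (hc₂ δ hδ)
  have hc₀ := hc₂ δ₀ hδ₀
  obtain ⟨n₂, hn₂⟩ := exists_nat_ge (((k : ℝ) ^ 2 + k) / (min c (c₂ δ₀) / 2))
  refine ⟨δ₀, hδ₀, max 1 (max n₁ n₂), ?_⟩
  intro U _ _ E hn h1 h2 hdvd
  simp only [max_le_iff] at hn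
  have hn0 : (0 : ℝ) < Nat.card U := by exact_mod_cast hn.1
  have : Nonempty U := (Nat.card_pos_iff.1 hn.1).1
  have hsmall : ((k : ℝ) ^ 2 + k) / Nat.card U ≤ min c (c₂ δ₀) / 2 := by
    rw [div_le_iff₀ hn0]
    rw [div_le_iff₀ (by positivity)] at hn₂
    have : (n₂ : ℝ) ≤ Nat.card U := by exact_mod_cast hn.2.2
    calc _ ≤ _ := hn₂
      _ ≤ Nat.card U * (min c (c₂ δ₀) / 2) := by gcongr
      _ = _ := by ring
  have hm1 := min_le_left c (c₂ δ₀)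
  have hm2 := min_le_right c (c₂ δ₀)
  refine hn₁ U (Family (Hom E)) (fun X hX => by rw [hX.card, Fintype.card_fin]) hn.2.1 ?_ ?_
    (by rwa [Fintype.card_fin])
  · intro x
    have := le_fr_family (Hom E) x
    have := h1 x
    linarith
  · intro δ hδ A A' hA hA'
    have e1 := le_fr_family_prod (Hom E) fun w => (∀ i, A (w.1 i)) ∧ A' w.2
    have e2 := h2 δ hδ A A' hA hA'
    have e3 := hmono δ₀ δ hδ₀ hδ
    simp only [and_assoc] at e1 e2
    linarith

theorem mainTheorem2 (α p : ℝ) (hα₀ : 0 < α) (hα₁ : α < 1) (hp₀ : 0 < p) (hp₁ : p < 1) :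
    ∃ (n₀ : ℕ) (μ : ℝ), 0 < μ ∧ μ < 1 ∧
      ∀ (n : ℕ), n₀ ≤ n → ∀ (V : Type*) (H : Hypergraph V),
        H.IsQuasirandomKGraph 3 n p μ α →
          (4 ∣ n → Hypergraph.HasPerfectPacking Hypergraph.cherry H) ∧
          (6 ∣ n → Hypergraph.HasPerfectPacking Hypergraph.cycleFour H) := by
  classical
  obtain ⟨δ₁, hδ₁, n₁, h₁⟩ := exists_pack_of_homCounts (k := 3) CherryHom
    (c := (α / 4) ^ 2) (by positivity) (fun δ => (p * δ ^ 3 / 2) ^ 2)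
    (fun δ hδ => by positivity) (fun δ δ' hδ h => by gcongr)
  obtain ⟨δ₂, hδ₂, n₂, h₂⟩ := exists_pack_of_homCounts (k := 5) CycleHom
    (c := (p * (α / 4) / 4) ^ 2) (by positivity) (fun δ => (p ^ 2 * δ ^ 5 / 8) ^ 2)
    (fun δ hδ => by positivity) (fun δ δ' hδ h => by gcongr)
  -- `μ` can be chosen last: the thresholds `δ₁`, `δ₂` depend only on `α` and `p`, and smaller
  -- densities are never needed.
  refine ⟨max 2 (max n₁ n₂), min (min (1 / 2) (p * (α / 4) / 4)) (min (p * δ₁ ^ 3 / 2)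
    (min (p * δ₂ ^ 3 / 2) (p ^ 2 * δ₂ ^ 5 / 8))), by positivity, ?_, ?_⟩
  · exact ((min_le_left _ _).trans (min_le_left _ _)).trans_lt (by norm_num)
  intro n hn V H hH
  set μ := min (min (1 / 2) (p * (α / 4) / 4)) (min (p * δ₁ ^ 3 / 2)
    (min (p * δ₂ ^ 3 / 2) (p ^ 2 * δ₂ ^ 5 / 8))) with hμ
  have hμ₁ : μ ≤ p * (α / 4) / 4 := (min_le_left _ _).trans (min_le_right _ _)
  have hμ₂ : μ ≤ p * δ₁ ^ 3 / 2 := (min_le_right _ _).trans (min_le_left _ _)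
  have hμ₃ : μ ≤ p * δ₂ ^ 3 / 2 :=
    (min_le_right _ _).trans ((min_le_right _ _).trans (min_le_left _ _))
  have hμ₄ : μ ≤ p ^ 2 * δ₂ ^ 5 / 8 :=
    (min_le_right _ _).trans ((min_le_right _ _).trans (min_le_right _ _))
  simp only [max_le_iff] at hn
  have hfin : Finite V(H) := hH.isKGraph.1
  have := Fintype.ofFinite V(H)
  have hcard : Nat.card V(H) = n := by rw [Nat.card_coe_set_eq, hH.card_vertexSet]
  have hne : Nonempty V(H) := (Nat.card_pos_iff.1 (by omega)).1
  have hE := hH.le_fr_edges (by omega)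
  have hL := hH.le_fr_link hα₀.le hn.1
  set E : V(H) → V(H) → V(H) → Prop := fun x y z =>
    ({(x : V), (y : V), (z : V)} : Set V) ∈ E(H) with hEdef
  constructor
  · intro hdvd
    apply hasPerfectPacking_of_pack rfl
    have hx : ∀ x, (α / 4) ^ 2 ≤ fr fun S : Fin 3 → V(H) => CherryHom E (Fin.cons x S) :=
      fun x => sq_le_fr_cherryHom (E := E) (by positivity) (hL x)
    have key := h₁ V(H) E (by omega) hx
      (fun δ hδ A A' hA hA' => sq_le_fr_cherryHom_prod (E := E) hp₀.le (hδ₁.trans_le hδ).le hE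
        (hμ₂.trans (by have : δ₁ ≤ δ := hδ; gcongr)) hA hA') (by rwa [hcard])
    convert key using 3 with f
    simp [Hypergraph.cherry, CherryHom, Set.image_insert_eq, hEdef]
  · intro hdvd
    apply hasPerfectPacking_of_pack rfl
    have hx : ∀ x, (p * (α / 4) / 4) ^ 2 ≤ fr fun S : Fin 5 → V(H) => CycleHom E (Fin.cons x S) :=
      fun x => sq_le_fr_cycleHom (E := E) hp₀ (by positivity) hμ₁ hE (hL x)
    have key := h₂ V(H) E (by omega) hx
      (fun δ hδ A A' hA hA' => sq_le_fr_cycleHom_prod (E := E) hp₀ (hδ₂.trans_le hδ) hE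
        (hμ₃.trans (by gcongr)) (hμ₄.trans (by gcongr)) hA hA') (by rwa [hcard])
    convert key using 3 with f
    simp [Hypergraph.cycleFour, CycleHom, Set.image_insert_eq, hEdef, and_assoc]
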